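/- Fix $\sigma>0$ and $\varepsilon>0$, and let $n,p,k,k^*$ be positive integers varying along a sequence such that $k^*\ge 2k$, $k^*/p\to 0$ and $(k^*\log p)/n\to 0$. For $\beta\in\Theta_k:=\{\beta\in\mathbb R^p:\ \beta \text{ has at most } k \text{ non-zero coordinates}\}$ let $y=X\beta+z$, where $X\in\mathbb R^{n\times p}$ has i.i.d. $\mathcal N(0,1)$ entries, $z\in\mathbb R^n$ has i.i.d. $\mathcal N(0,\sigma^2)$ entries, and $X$ and $z$ are independent. Write $X_i$ for the $i$-th column of $X$, $X_A$ for the submatrix of the columns indexed by $A\subseteq\{1,\dots,p\}$, and $\operatorname{supp}(v)=\{i: v_i\neq 0\}$. Put $$\lambda=(1+\varepsilon)\sigma\sqrt{\frac{2\log(p/k)}{n}},\qquad \Delta=10\sqrt{\frac{k^*\log(p/k^*)}{n}}.$$ Let $\hat\beta^L\in\arg\min_{b\in\mathbb R^p}\frac1{2n}\|y-Xb\|_2^2+\lambda\|b\|_1$ be the Lasso estimator (any minimizer), and let $\tilde\beta^O=\eta_\lambda(\beta+X^Tz/n)$ be the soft-thresholding oracle, where $[\eta_\lambda(u)]_i=\operatorname{sign}(u_i)(|u_i|-\lambda)_+$,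 i.e. $\eta_\lambda(u)=\arg\min_b \frac12\|u-b\|_2^2+\lambda\|b\|_1$. Let the resolvent set $S_*$ be the union of $S=\operatorname{supp}(\beta)$ and the $k^*-k$ indices $i\in\{1,\dots,p\}\setminus S$ with the largest values of $|X_i^Tz|$ (ties broken arbitrarily). Call a set $A\subseteq\{1,\dots,p\}$ good if $\operatorname{supp}(\hat\beta^L)\cup\operatorname{supp}(\tilde\beta^O)\cup\operatorname{supp}(\beta)\subseteq A$ (for every Lasso minimizer $\hat\beta^L$) and all eigenvalues of $X_A^TX_A/n$ lie in $[1-\Delta,1+\Delta]$; let $\mathcal B_\Delta$ be the event that some good set exists. Then, uniformly over $\beta\in\Theta_k$, the resolvent set is good with probability tending to one: $$\sup_{\beta\in\Theta_k}\mathbb P\big(S_* \text{ is not good}\big)\to 0$$ (here $S_*$ exists as soon as $k^*\le p$, hence for all but finitely many indices of the sequence; where it does not exist, this probability is read as $1$), and consequently $\sup_{\beta\in\Theta_k}\mathbb P(\mathcal B_\Delta^c)\to 0$. -/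

import Mathlib

open MeasureTheory ProbabilityTheory Filter Topology

namespace SparseLasso

noncomputable section

/-- The joint law of the pair `(X, z)`: the `n × p` design `X` has i.i.d. `N(0, 1)` entries
(its rows are i.i.d. `N(0, I_p)`), the noise `z` has i.i.d. `N(0, σ²)` entries, and `X` and `z`
are independent. -/
def modelLaw (n p : ℕ) (σ : ℝ) : Measure ((Fin n → Fin p → ℝ) × (Fin n → ℝ)) :=
  (Measure.pi fun _ : Fin n => Measure.pi fun _ : Fin p => gaussianReal 0 1).prod
    (Measure.pi fun _ : Fin n => gaussianReal 0 (Real.toNNReal (σ ^ 2)))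

instance (n p : ℕ) (σ : ℝ) : IsProbabilityMeasure (modelLaw n p σ) := by
  unfold modelLaw
  infer_instance

/-- The support of a vector. -/
def supp {p : ℕ} (b : Fin p → ℝ) : Finset (Fin p) :=
  Finset.univ.filter fun j => b j ≠ 0

/-- The parameter space `Θ_k` of `k`-sparse vectors. -/
def sparseVectors (p k : ℕ) : Set (Fin p → ℝ) :=
  {β | (supp β).card ≤ k}

/-- The response `y = X β + z`. -/
def response {n p : ℕ} (X : Matrix (Fin n) (Fin p) ℝ) (β : Fin p → ℝ) (z : Fin n → ℝ) :
    Fin n → ℝ :=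
  X.mulVec β + z

/-- The Lasso objective `‖y - X b‖₂² / (2 n) + lam ‖b‖₁`. -/
def lassoObjective {n p : ℕ} (X : Matrix (Fin n) (Fin p) ℝ) (y : Fin n → ℝ) (lam : ℝ)
    (b : Fin p → ℝ) : ℝ :=
  1 / (2 * (n : ℝ)) * ∑ i, (y i - X.mulVec b i) ^ 2 + lam * ∑ j, |b j|

/-- `b` is a Lasso estimator, that is, a global minimizer of the Lasso objective. -/
def IsLasso {n p : ℕ} (X : Matrix (Fin n) (Fin p) ℝ) (y : Fin n → ℝ) (lam : ℝ)
    (b : Fin p → ℝ) : Prop :=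
  ∀ b' : Fin p → ℝ, lassoObjective X y lam b ≤ lassoObjective X y lam b'

/-- For a positive tuning parameter a Lasso estimator exists. -/
theorem exists_isLasso {n p : ℕ} (X : Matrix (Fin n) (Fin p) ℝ) (y : Fin n → ℝ) {lam : ℝ}
    (hlam : 0 < lam) : ∃ b, IsLasso X y lam b := by
  have hcont : Continuous (lassoObjective X y lam) := by
    unfold lassoObjective Matrix.mulVec dotProduct
    fun_prop
  refine hcont.exists_forall_le ?_
  have h1 : Tendsto (fun b : Fin p → ℝ => lam * ‖b‖) (cocompact _) atTop :=
    (tendsto_norm_cocompact_atTop).const_mul_atTop hlam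
  refine tendsto_atTop_mono (fun b => ?_) h1
  have h2 : ‖b‖ ≤ ∑ j, |b j| := by
    refine (pi_norm_le_iff_of_nonneg (Finset.sum_nonneg fun j _ => abs_nonneg _)).2 fun j => ?_
    rw [Real.norm_eq_abs]
    exact Finset.single_le_sum (f := fun j => |b j|) (fun j _ => abs_nonneg _)
      (Finset.mem_univ j)
  have h3 : 0 ≤ 1 / (2 * (n : ℝ)) * ∑ i, (y i - X.mulVec b i) ^ 2 := by positivity
  have h4 := mul_le_mul_of_nonneg_left h2 hlam.le
  unfold lassoObjective
  linarith

/-- The (coordinatewise) soft thresholding map `η_lam`. -/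
def softThreshold {p : ℕ} (lam : ℝ) (u : Fin p → ℝ) : Fin p → ℝ :=
  fun j => Real.sign (u j) * max (|u j| - lam) 0

/-- The scalar inequality behind soft thresholding, with its quadratic gap. -/
theorem softThreshold_gap {lam : ℝ} (hlam : 0 ≤ lam) (u c : ℝ) :
    (u - Real.sign u * max (|u| - lam) 0) ^ 2 / 2 + lam * |Real.sign u * max (|u| - lam) 0|
      + (c - Real.sign u * max (|u| - lam) 0) ^ 2 / 2 ≤ (u - c) ^ 2 / 2 + lam * |c| := by
  have hc1 := le_abs_self c
  have hc2 := neg_abs_le c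
  have hc3 := abs_nonneg c
  rcases lt_trichotomy u 0 with h | h | h
  · rw [Real.sign_of_neg h, abs_of_neg h]
    rcases le_total (-u - lam) 0 with h' | h'
    · rw [max_eq_right h']
      simp
      nlinarith [mul_nonneg hc3 (sub_nonneg.2 (show -u ≤ lam by linarith)),
        mul_nonneg (neg_nonneg.2 h.le) (show 0 ≤ |c| + c by linarith)]
    · rw [max_eq_left h', show (-1 : ℝ) * (-u - lam) = u + lam by ring,
        abs_of_nonpos (show u + lam ≤ 0 by linarith)]
      nlinarith [mul_nonneg hlam (show 0 ≤ |c| + c by linarith)]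
  · subst h
    rw [Real.sign_zero]
    simp
    nlinarith [mul_nonneg hlam hc3]
  · rw [Real.sign_of_pos h, abs_of_pos h]
    rcases le_total (u - lam) 0 with h' | h'
    · rw [max_eq_right h']
      simp
      nlinarith [mul_nonneg hc3 (sub_nonneg.2 (show u ≤ lam by linarith)),
        mul_nonneg h.le (show 0 ≤ |c| - c by linarith)]
    · rw [max_eq_left h', one_mul, abs_of_nonneg h']
      nlinarith [mul_nonneg hlam (show 0 ≤ |c| - c by linarith)]

/-- `η_lam(u)` is the unique minimizer of `b ↦ ‖u - b‖₂² / 2 + lam ‖b‖₁`. -/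
theorem softThreshold_unique_argmin {p : ℕ} {lam : ℝ} (hlam : 0 ≤ lam) (u b : Fin p → ℝ) :
    b = softThreshold lam u ↔ ∀ b' : Fin p → ℝ,
      1 / 2 * ∑ j, (u j - b j) ^ 2 + lam * ∑ j, |b j| ≤
        1 / 2 * ∑ j, (u j - b' j) ^ 2 + lam * ∑ j, |b' j| := by
  have key : ∀ c : Fin p → ℝ,
      1 / 2 * ∑ j, (u j - softThreshold lam u j) ^ 2 + lam * ∑ j, |softThreshold lam u j|
        + ∑ j, (c j - softThreshold lam u j) ^ 2 / 2 ≤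
        1 / 2 * ∑ j, (u j - c j) ^ 2 + lam * ∑ j, |c j| := by
    intro c
    have h := Finset.sum_le_sum fun j (_ : j ∈ Finset.univ) =>
      softThreshold_gap hlam (u j) (c j)
    simp only [Finset.sum_add_distrib, ← Finset.mul_sum, ← Finset.sum_div] at h
    simp only [softThreshold, ← Finset.sum_div]
    linarith
  have hnn : ∀ c : Fin p → ℝ, ∀ j ∈ Finset.univ,
      0 ≤ (c j - softThreshold lam u j) ^ 2 / 2 := fun c j _ => by positivity
  constructor
  · rintro rfl b'
    have h1 := key b'
    have h2 := Finset.sum_nonneg (hnn b')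
    linarith
  · intro h
    have h1 := key b
    have h2 := h (softThreshold lam u)
    have h3 : ∑ j, (b j - softThreshold lam u j) ^ 2 / 2 = 0 :=
      le_antisymm (by linarith) (Finset.sum_nonneg (hnn b))
    rw [Finset.sum_eq_zero_iff_of_nonneg (hnn b)] at h3
    funext j
    have h4 := h3 j (Finset.mem_univ j)
    have h5 : (b j - softThreshold lam u j) ^ 2 = 0 := by linarith
    exact sub_eq_zero.1 (pow_eq_zero_iff (two_ne_zero) |>.1 h5)

/-- The soft-thresholding oracle `η_lam(β + Xᵀ z / n)`. -/
def oracle {n p : ℕ} (X : Matrix (Fin n) (Fin p) ℝ) (β : Fin p → ℝ) (z : Fin n → ℝ)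
    (lam : ℝ) : Fin p → ℝ :=
  softThreshold lam (β + (n : ℝ)⁻¹ • X.transpose.mulVec z)

/-- The tuning parameter `lam_ε = (1 + ε) σ √(2 log(p / k) / n)`. -/
def tuning (n p k : ℕ) (σ ε : ℝ) : ℝ :=
  (1 + ε) * σ * Real.sqrt (2 * Real.log ((p : ℝ) / k) / n)

/-- `Δ = 10 √(k* log(p / k*) / n)`. -/
def gap (n p kstar : ℕ) : ℝ :=
  10 * Real.sqrt ((kstar : ℝ) * Real.log ((p : ℝ) / kstar) / n)

/-- `Sstar` is a resolvent set for the support `S`: it is the union of `S` and of a set `T` of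
`kstar - k` indices outside `S` at which `|X_iᵀ z|` takes its largest values among the indices
outside `S`. (Ties may be broken in any way.) -/
def IsResolventSet {n p : ℕ} (X : Matrix (Fin n) (Fin p) ℝ) (z : Fin n → ℝ)
    (S : Finset (Fin p)) (k kstar : ℕ) (Sstar : Finset (Fin p)) : Prop :=
  ∃ T : Finset (Fin p), Disjoint S T ∧ T.card = kstar - k ∧
    (∀ i ∈ T, ∀ j, j ∉ S → j ∉ T →
      |X.transpose.mulVec z j| ≤ |X.transpose.mulVec z i|) ∧
    Sstar = S ∪ T

/-- Resolvent sets exist as soon as `kstar - k` indices are available outside `S`. -/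
theorem exists_isResolventSet {n p : ℕ} (X : Matrix (Fin n) (Fin p) ℝ) (z : Fin n → ℝ)
    (S : Finset (Fin p)) (k kstar : ℕ) (h : S.card + (kstar - k) ≤ p) :
    ∃ Sstar, IsResolventSet X z S k kstar Sstar := by
  have hcard : kstar - k ≤ (Sᶜ).card := by
    rw [Finset.card_compl, Fintype.card_fin]
    omega
  obtain ⟨T, hT, hmax⟩ := Finset.exists_max_image ((Sᶜ).powersetCard (kstar - k))
    (fun T => ∑ i ∈ T, |X.transpose.mulVec z i|) (Finset.powersetCard_nonempty.2 hcard)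
  rw [Finset.mem_powersetCard] at hT
  refine ⟨S ∪ T, T, ?_, hT.2, ?_, rfl⟩
  · rw [Finset.disjoint_left]
    intro i hi hi'
    exact (Finset.mem_compl.1 (hT.1 hi')) hi
  · intro i hi j hjS hjT
    have hj : j ∉ T.erase i := fun hj => hjT (Finset.mem_of_mem_erase hj)
    have h1 := hmax (insert j (T.erase i)) (Finset.mem_powersetCard.2 ⟨?_, ?_⟩)
    · simp only [Finset.sum_insert hj] at h1
      have h2 := Finset.add_sum_erase T (fun i => |X.transpose.mulVec z i|) hi
      linarith
    · intro a ha
      rcases Finset.mem_insert.1 ha with rfl | ha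
      · exact Finset.mem_compl.2 hjS
      · exact hT.1 (Finset.mem_of_mem_erase ha)
    · rw [Finset.card_insert_of_notMem hj, Finset.card_erase_of_mem hi, ← hT.2]
      have := Finset.card_pos.2 ⟨i, hi⟩
      omega

/-- The normalized Gram matrix `X_Sᵀ X_S / n` of the columns indexed by `S`. -/
def gram {n p : ℕ} (X : Matrix (Fin n) (Fin p) ℝ) (S : Finset (Fin p)) :
    Matrix {j // j ∈ S} {j // j ∈ S} ℝ :=
  (n : ℝ)⁻¹ • ((X.submatrix id Subtype.val).transpose * X.submatrix id Subtype.val)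

/-- The two conditions on a set `Sstar` of indices: it contains the supports of the Lasso (of
every minimizer, should there be several), of the oracle and of `β`, and all eigenvalues of
`X_{Sstar}ᵀ X_{Sstar} / n` lie in `[1 - Δ, 1 + Δ]`. -/
def GoodSet {n p : ℕ} (X : Matrix (Fin n) (Fin p) ℝ) (β : Fin p → ℝ) (z : Fin n → ℝ)
    (lam Δ : ℝ) (Sstar : Finset (Fin p)) : Prop :=
  (∀ b, IsLasso X (response X β z) lam b → supp b ⊆ Sstar) ∧
  supp (oracle X β z lam) ⊆ Sstar ∧
  supp β ⊆ Sstar ∧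
  ∀ t : ℝ, Module.End.HasEigenvalue (Matrix.toLin' (gram X Sstar)) t →
    t ∈ Set.Icc (1 - Δ) (1 + Δ)

/-- The event that there is a resolvent set and every resolvent set is good. -/
def resolventEvent (n p k kstar : ℕ) (σ ε : ℝ) (β : Fin p → ℝ) :
    Set ((Fin n → Fin p → ℝ) × (Fin n → ℝ)) :=
  {ω | (∃ Sstar, IsResolventSet (Matrix.of ω.1) ω.2 (supp β) k kstar Sstar) ∧
    ∀ Sstar, IsResolventSet (Matrix.of ω.1) ω.2 (supp β) k kstar Sstar →
      GoodSet (Matrix.of ω.1) β ω.2 (tuning n p k σ ε) (gap n p kstar) Sstar}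

/-- The event `B_Δ` that some set of indices is good. -/
def eventB (n p k : ℕ) (σ ε Δ : ℝ) (β : Fin p → ℝ) :
    Set ((Fin n → Fin p → ℝ) × (Fin n → ℝ)) :=
  {ω | ∃ Sstar, GoodSet (Matrix.of ω.1) β ω.2 (tuning n p k σ ε) Δ Sstar}

end

end SparseLasso

namespace SparseLasso

/-! Fix the noise `z`, put `u = z/‖z‖` and `a = (1 + ε/4)√(2 log(p/k))`, and let the screened set
`T` consist of `S` and all `j` with `|X_jᵀz| > a‖z‖`. The plan is to trap every Lasso minimizer and
the oracle in `T`, and `T` in every resolvent set.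

The vector `Xᵀu` is standard Gaussian, and its energy on `T` has expectation of order `k`. By Markov
this energy is at most `k log(p/k)` with high probability (`gaussVec_energy_gt_le`). Each index of
`T \ S` carries energy above `a² ≥ log(p/k)`, so at most `k` indices lie outside `S`. As `k ≤ k* -
k` and resolvent sets collect the largest `|X_jᵀz|`, they contain `T`
(`IsResolventSet.screenedSet_subset`).

For the Lasso a primal-dual witness is used: let `b` solve the problem restricted to the columns in
`T`. Restricted isometry and the energy bound give `‖X(b - β)‖ ≤ ρ` (`IsLasso.prediction_error_le`).
If `|X_jᵀ(y - Xb)| < nλ` for all `j ∉ T`, every minimizer of the full problem is supported in `T`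
(`IsLasso.supp_subset_of_strict`). Here `X_jᵀ(y - Xb) = X_jᵀz - X_jᵀX(b - β)`, and the first term is
at most `a‖z‖` by screening. For the second, `T` depends on `X_j` only through `X_jᵀu`, and when `j
∉ T` neither the restricted problem nor its fit involves `X_j`. The part of `X_j` orthogonal to `u`
can therefore be resampled without changing the law of `X` (`map_resampleColumn`), so its
contribution is Gaussian with variance at most `ρ²`, while the part along `u` contributes at most
`aρ`. A union bound over `j` concludes (`gaussMat_leakEvent_le`).

The eigenvalue condition is restricted isometry at level `Δ`, uniform over sets of size `k*`,
obtained from a net and chi-square tails (`gaussMat_not_restrictedIsometry_le`). -/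

/-- The standard Gaussian law on `ι → ℝ`. -/
noncomputable abbrev gaussVec (ι : Type*) [Fintype ι] : Measure (ι → ℝ) :=
  Measure.pi fun _ => gaussianReal 0 1

/-- The law of an `ι × κ` matrix with i.i.d. standard Gaussian entries. -/
noncomputable abbrev gaussMat (ι κ : Type*) [Fintype ι] [Fintype κ] : Measure (ι → κ → ℝ) :=
  Measure.pi fun _ => gaussVec κ

/-! ### Gaussian laws identified by characteristic functions -/

section CharacteristicFunctions

variable {ι κ Ω : Type*} [Fintype ι] [Fintype κ] [MeasurableSpace Ω]

theorem integral_cexp_gaussVec (t : ι → ℝ) :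
    ∫ x, Complex.exp (((∑ i, t i * x i : ℝ) : ℂ) * Complex.I) ∂gaussVec ι =
      Complex.exp (((-(∑ i, t i ^ 2) / 2 : ℝ) : ℂ)) := by
  have h1 : ∀ x : ι → ℝ, Complex.exp (((∑ i, t i * x i : ℝ) : ℂ) * Complex.I) =
      ∏ i, Complex.exp ((t i : ℂ) * (x i : ℂ) * Complex.I) := by
    intro x
    rw [← Complex.exp_sum]
    push_cast
    rw [Finset.sum_mul]
  simp_rw [h1]
  rw [integral_fintype_prod_eq_prod (𝕜 := ℂ)
    (fun i (x : ℝ) => Complex.exp ((t i : ℂ) * (x : ℂ) * Complex.I))]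
  have h2 : ∀ i, ∫ x, Complex.exp ((t i : ℂ) * (x : ℂ) * Complex.I) ∂gaussianReal 0 1 =
      Complex.exp (-(t i : ℂ) ^ 2 / 2) := by
    intro i
    rw [← charFun_apply_real, charFun_gaussianReal]
    congr 1
    simp
    ring
  simp_rw [h2]
  rw [← Complex.exp_sum]
  congr 1
  push_cast
  rw [← Finset.sum_div, Finset.sum_neg_distrib]

theorem integral_cexp_gaussMat (t : ι → κ → ℝ) :
    ∫ x, Complex.exp (((∑ i, ∑ j, t i j * x i j : ℝ) : ℂ) * Complex.I) ∂gaussMat ι κ =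
      Complex.exp (((-(∑ i, ∑ j, t i j ^ 2) / 2 : ℝ) : ℂ)) := by
  have h1 : ∀ x : ι → κ → ℝ,
      Complex.exp (((∑ i, ∑ j, t i j * x i j : ℝ) : ℂ) * Complex.I) =
      ∏ i, Complex.exp (((∑ j, t i j * x i j : ℝ) : ℂ) * Complex.I) := by
    intro x
    rw [← Complex.exp_sum, Complex.ofReal_sum, Finset.sum_mul]
  simp_rw [h1]
  rw [integral_fintype_prod_eq_prod (𝕜 := ℂ)
    (fun i (x : κ → ℝ) => Complex.exp (((∑ j, t i j * x j : ℝ) : ℂ) * Complex.I))]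
  simp_rw [integral_cexp_gaussVec]
  rw [← Complex.exp_sum]
  congr 1
  push_cast
  rw [← Finset.sum_div, Finset.sum_neg_distrib]

/-- Finite measures on a finite-dimensional space are determined by their characteristic functions,
and every continuous functional has the form `x ↦ ∑ tᵢ xᵢ`. -/
theorem map_eq_gaussVec (P : Measure Ω) [IsProbabilityMeasure P] {f : Ω → κ → ℝ}
    (hf : Measurable f)
    (h : ∀ t : κ → ℝ, ∫ ω, Complex.exp (((∑ i, t i * f ω i : ℝ) : ℂ) * Complex.I) ∂P =
      Complex.exp (((-(∑ i, t i ^ 2) / 2 : ℝ) : ℂ))) :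
    P.map f = gaussVec κ := by
  classical
  have : IsProbabilityMeasure (P.map f) := Measure.isProbabilityMeasure_map hf.aemeasurable
  refine Measure.ext_of_charFunDual ?_
  ext L
  have hL : ∀ x : κ → ℝ, L x = ∑ i, L (Pi.single i 1) * x i := by
    intro x
    conv_lhs => rw [pi_eq_sum_univ' x]
    simp only [map_sum, map_smul, smul_eq_mul]
    refine Finset.sum_congr rfl fun i _ => ?_
    rw [mul_comm]
  rw [charFunDual_apply, charFunDual_apply, integral_map hf.aemeasurable]
  · refine (integral_congr_ae (.of_forall fun ω => ?_)).trans ((h fun i =>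
      L (Pi.single i 1)).trans ((integral_cexp_gaussVec _).symm.trans
        (integral_congr_ae (.of_forall fun x => ?_)))) <;> simp only [← hL]
  · have : Continuous fun v : κ → ℝ => Complex.exp ((L v : ℂ) * Complex.I) := by fun_prop
    exact this.aestronglyMeasurable

theorem map_eq_gaussMat (P : Measure Ω) [IsProbabilityMeasure P] {f : Ω → ι → κ → ℝ}
    (hf : Measurable f)
    (h : ∀ t : ι → κ → ℝ,
      ∫ ω, Complex.exp (((∑ i, ∑ j, t i j * f ω i j : ℝ) : ℂ) * Complex.I) ∂P =
      Complex.exp (((-(∑ i, ∑ j, t i j ^ 2) / 2 : ℝ) : ℂ))) :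
    P.map f = gaussMat ι κ := by
  classical
  have : IsProbabilityMeasure (P.map f) := Measure.isProbabilityMeasure_map hf.aemeasurable
  refine Measure.ext_of_charFunDual ?_
  ext L
  have hL : ∀ x : ι → κ → ℝ, L x = ∑ i, ∑ j, L (Pi.single i (Pi.single j 1)) * x i j := by
    intro x
    have hx : x = ∑ i, ∑ j, x i j • (Pi.single i (Pi.single j (1 : ℝ)) : ι → κ → ℝ) := by
      ext a b
      simp only [Finset.sum_apply, Pi.smul_apply, smul_eq_mul]
      rw [Finset.sum_eq_single a, Finset.sum_eq_single b]
      · simp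
      · intro c _ hc
        simp [hc.symm]
      · simp
      · intro c _ hc
        simp [hc.symm]
      · simp
    conv_lhs => rw [hx]
    simp only [map_sum, map_smul, smul_eq_mul]
    exact Finset.sum_congr rfl fun i _ => Finset.sum_congr rfl fun j _ => mul_comm _ _
  rw [charFunDual_apply, charFunDual_apply, integral_map hf.aemeasurable]
  · refine (integral_congr_ae (.of_forall fun ω => ?_)).trans ((h fun i j =>
      L (Pi.single i (Pi.single j 1))).trans ((integral_cexp_gaussMat _).symm.trans
        (integral_congr_ae (.of_forall fun x => ?_)))) <;> simp only [← hL]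
  · have : Continuous fun v : ι → κ → ℝ => Complex.exp ((L v : ℂ) * Complex.I) := by fun_prop
    exact this.aestronglyMeasurable

end CharacteristicFunctions

/-! ### Invariance properties of Gaussian matrices -/

section Laws

variable {ι κ : Type*} [Fintype ι] [Fintype κ]

/-- Pairing `Xu` with `t` is pairing `X` with the rank-one matrix `t uᵀ`, whose Frobenius norm is
that of `t` because `u` is a unit vector. -/
theorem gaussMat_map_mulVec (u : κ → ℝ) (hu : ∑ j, u j ^ 2 = 1) :
    (gaussMat ι κ).map (fun X i => ∑ j, X i j * u j) = gaussVec ι := by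
  refine map_eq_gaussVec _ (by fun_prop) fun t => ?_
  have h := integral_cexp_gaussMat (ι := ι) (κ := κ) fun i j => t i * u j
  have e1 : ∀ x : ι → κ → ℝ, ∑ i, ∑ j, t i * u j * x i j = ∑ i, t i * ∑ j, x i j * u j := by
    intro x
    simp_rw [Finset.mul_sum]
    exact Finset.sum_congr rfl fun i _ => Finset.sum_congr rfl fun j _ => by ring
  have e2 : ∑ i, ∑ j, (t i * u j) ^ 2 = ∑ i, t i ^ 2 := by
    simp_rw [mul_pow, ← Finset.mul_sum, hu, mul_one]
  simp_rw [e1, e2] at h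
  exact h

theorem gaussMat_map_transpose_mulVec (u : ι → ℝ) (hu : ∑ i, u i ^ 2 = 1) :
    (gaussMat ι κ).map (fun X j => ∑ i, X i j * u i) = gaussVec κ := by
  refine map_eq_gaussVec _ (by fun_prop) fun t => ?_
  have h := integral_cexp_gaussMat (ι := ι) (κ := κ) fun i j => u i * t j
  have e1 : ∀ x : ι → κ → ℝ, ∑ i, ∑ j, u i * t j * x i j = ∑ j, t j * ∑ i, x i j * u i := by
    intro x
    rw [Finset.sum_comm]
    simp_rw [Finset.mul_sum]
    exact Finset.sum_congr rfl fun i _ => Finset.sum_congr rfl fun j _ => by ring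
  have e2 : ∑ i, ∑ j, (u i * t j) ^ 2 = ∑ j, t j ^ 2 := by
    simp_rw [mul_pow, ← Finset.mul_sum]
    rw [← Finset.sum_mul, hu, one_mul]
  simp_rw [e1, e2] at h
  exact h

/-- Replace the component of the `j`-th column of `X` orthogonal to `u` by that of `y`. -/
noncomputable def resampleColumn [DecidableEq κ] (u : ι → ℝ) (j : κ) (X : ι → κ → ℝ)
    (y : ι → ℝ) : ι → κ → ℝ :=
  fun i l => if l = j then u i * ∑ a, u a * X a j + (y i - u i * ∑ a, u a * y a) else X i l

/-- Resampling the component of a column orthogonal to a unit vector preserves the Gaussian law. -/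
theorem map_resampleColumn [DecidableEq κ] (u : ι → ℝ) (hu : ∑ i, u i ^ 2 = 1) (j : κ) :
    ((gaussMat ι κ).prod (gaussVec ι)).map (fun q => resampleColumn u j q.1 q.2) =
      gaussMat ι κ := by
  refine map_eq_gaussMat _ ?_ fun t => ?_
  · refine measurable_pi_lambda _ fun i => measurable_pi_lambda _ fun l => ?_
    unfold resampleColumn
    split_ifs <;> fun_prop
  -- By duality, the pairing of `t` with the resampled matrix is that of `s` with `X` plus that of
  -- `r` with `y`. In column `j`, `s` keeps the component of `t` along `u`, and `r` is the
  -- orthogonal remainder. Pythagoras (`e2`) then leaves the characteristic function unchanged.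
  set τ : ℝ := ∑ a, u a * t a j with hτ
  set s : ι → κ → ℝ := fun i l => if l = j then u i * τ else t i l with hs
  set r : ι → ℝ := fun i => t i j - u i * τ with hr
  have split : ∀ g : κ → ℝ, ∑ l, g l = g j + ∑ l ∈ Finset.univ.erase j, g l := fun g =>
    (Finset.add_sum_erase _ _ (Finset.mem_univ j)).symm
  have e1 : ∀ q : (ι → κ → ℝ) × (ι → ℝ), ∑ i, ∑ l, t i l * resampleColumn u j q.1 q.2 i l =
      ∑ i, ∑ l, s i l * q.1 i l + ∑ i, r i * q.2 i := by
    intro q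
    have h1 : ∀ i, ∑ l, t i l * resampleColumn u j q.1 q.2 i l =
        t i j * (u i * ∑ a, u a * q.1 a j + (q.2 i - u i * ∑ a, u a * q.2 a)) +
          ∑ l ∈ Finset.univ.erase j, t i l * q.1 i l := by
      intro i
      rw [split]
      congr 1
      · simp [resampleColumn]
      · refine Finset.sum_congr rfl fun l hl => ?_
        simp [resampleColumn, Finset.ne_of_mem_erase hl]
    have h2 : ∀ i, ∑ l, s i l * q.1 i l =
        u i * τ * q.1 i j + ∑ l ∈ Finset.univ.erase j, t i l * q.1 i l := by
      intro i
      rw [split]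
      congr 1
      · simp [hs]
      · refine Finset.sum_congr rfl fun l hl => ?_
        simp [hs, Finset.ne_of_mem_erase hl]
    simp_rw [h1, h2, Finset.sum_add_distrib]
    have h3 : ∑ i, t i j * (u i * ∑ a, u a * q.1 a j + (q.2 i - u i * ∑ a, u a * q.2 a)) =
        τ * (∑ a, u a * q.1 a j) + ∑ i, t i j * q.2 i - τ * ∑ a, u a * q.2 a := by
      rw [hτ, Finset.sum_mul, Finset.sum_mul, ← Finset.sum_add_distrib, ← Finset.sum_sub_distrib]
      exact Finset.sum_congr rfl fun i _ => by ring
    have h4 : ∑ i, u i * τ * q.1 i j = τ * ∑ a, u a * q.1 a j := by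
      rw [Finset.mul_sum]
      exact Finset.sum_congr rfl fun i _ => by ring
    have h5 : ∑ i, r i * q.2 i = ∑ i, t i j * q.2 i - τ * ∑ a, u a * q.2 a := by
      rw [Finset.mul_sum, ← Finset.sum_sub_distrib]
      exact Finset.sum_congr rfl fun i _ => by simp only [hr]; ring
    rw [h3, h4, h5]
    ring
  have e2 : ∑ i, ∑ l, s i l ^ 2 + ∑ i, r i ^ 2 = ∑ i, ∑ l, t i l ^ 2 := by
    have h1 : ∀ i, ∑ l, s i l ^ 2 =
        (u i * τ) ^ 2 + ∑ l ∈ Finset.univ.erase j, t i l ^ 2 := by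
      intro i
      rw [split]
      congr 1
      · simp [hs]
      · refine Finset.sum_congr rfl fun l hl => ?_
        simp [hs, Finset.ne_of_mem_erase hl]
    have h2 : ∑ i, r i ^ 2 = ∑ i, t i j ^ 2 - τ ^ 2 := by
      have : ∀ i, r i ^ 2 = t i j ^ 2 - 2 * τ * (u i * t i j) + τ ^ 2 * u i ^ 2 := by
        intro i
        simp only [hr]
        ring
      simp_rw [this]
      rw [Finset.sum_add_distrib, Finset.sum_sub_distrib, ← Finset.mul_sum, ← Finset.mul_sum, hu,
        ← hτ]
      ring
    have h3 : ∑ i, (u i * τ) ^ 2 = τ ^ 2 := by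
      simp_rw [mul_pow]
      rw [← Finset.sum_mul, hu, one_mul]
    have h4 : ∀ i, ∑ l, t i l ^ 2 = t i j ^ 2 + ∑ l ∈ Finset.univ.erase j, t i l ^ 2 :=
      fun i => split _
    simp_rw [h1, h4, Finset.sum_add_distrib]
    rw [h2, h3]
    ring
  have e3 : ∀ q : (ι → κ → ℝ) × (ι → ℝ),
      Complex.exp (((∑ i, ∑ l, t i l * resampleColumn u j q.1 q.2 i l : ℝ) : ℂ) * Complex.I) =
      Complex.exp (((∑ i, ∑ l, s i l * q.1 i l : ℝ) : ℂ) * Complex.I) *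
        Complex.exp (((∑ i, r i * q.2 i : ℝ) : ℂ) * Complex.I) := by
    intro q
    rw [e1, ← Complex.exp_add, Complex.ofReal_add, add_mul]
  simp_rw [e3]
  rw [integral_prod_mul
    (fun X : ι → κ → ℝ => Complex.exp (((∑ i, ∑ l, s i l * X i l : ℝ) : ℂ) * Complex.I))
    (fun y : ι → ℝ => Complex.exp (((∑ i, r i * y i : ℝ) : ℂ) * Complex.I)),
    integral_cexp_gaussMat, integral_cexp_gaussVec, ← Complex.exp_add, ← e2]
  congr 1
  push_cast
  ring

end Laws

/-! ### Chernoff bounds for chi-square variables and linear forms -/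

section Tails

theorem integral_exp_sq_gaussianReal {s : ℝ} (hs : s < 1 / 2) :
    ∫ x, Real.exp (s * x ^ 2) ∂gaussianReal 0 1 = (√(1 - 2 * s))⁻¹ := by
  rw [integral_gaussianReal_eq_integral_smul one_ne_zero]
  have h1 : ∀ x : ℝ, gaussianPDFReal 0 1 x • Real.exp (s * x ^ 2) =
      (√(2 * Real.pi))⁻¹ * Real.exp (-(1 / 2 - s) * x ^ 2) := by
    intro x
    rw [gaussianPDFReal_def, smul_eq_mul]
    simp only [NNReal.coe_one, mul_one, sub_zero]
    rw [mul_assoc, ← Real.exp_add]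
    congr 2
    ring
  simp_rw [h1]
  rw [integral_const_mul, integral_gaussian, ← Real.sqrt_inv, ← Real.sqrt_inv,
    ← Real.sqrt_mul (by positivity)]
  congr 1
  have h2 : (1 : ℝ) / 2 - s ≠ 0 := by linarith
  have h3 : (1 : ℝ) - 2 * s ≠ 0 := by linarith
  have h4 := Real.pi_ne_zero
  field_simp

theorem integrable_exp_sq_gaussianReal {s : ℝ} (hs : s < 1 / 2) :
    Integrable (fun x => Real.exp (s * x ^ 2)) (gaussianReal 0 1) := by
  refine Integrable.of_integral_ne_zero ?_
  rw [integral_exp_sq_gaussianReal hs]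
  have : 0 < 1 - 2 * s := by linarith
  positivity

/-- This is `-log(1 - x) ≤ x + x²` without the logarithm. With `x = 2s` it bounds the moment
generating function `(1 - 2s)^(-1/2)` of a squared Gaussian. -/
theorem one_le_one_sub_mul_exp {x : ℝ} (h2 : x ≤ 1 / 2) :
    1 ≤ (1 - x) * Real.exp (x + x ^ 2) := by
  rcases le_total 0 x with h | h
  · have := Real.quadratic_le_exp_of_nonneg (show 0 ≤ x + x ^ 2 by positivity)
    have h3 : (1 - x) * (1 + (x + x ^ 2) + (x + x ^ 2) ^ 2 / 2) ≤
        (1 - x) * Real.exp (x + x ^ 2) :=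
      mul_le_mul_of_nonneg_left this (by linarith)
    refine le_trans ?_ h3
    have h4 : 0 ≤ (1 - x) * (1 + x) ^ 2 - 2 * x := by nlinarith [mul_nonneg h h]
    nlinarith [mul_nonneg (sq_nonneg x) h4]
  · have := Real.add_one_le_exp (x + x ^ 2)
    have h3 : (1 - x) * (x + x ^ 2 + 1) ≤ (1 - x) * Real.exp (x + x ^ 2) :=
      mul_le_mul_of_nonneg_left this (by linarith)
    refine le_trans ?_ h3
    nlinarith [mul_nonneg (sq_nonneg x) (neg_nonneg.2 h)]

theorem integral_exp_sq_gaussianReal_le {s : ℝ} (h2 : s ≤ 1 / 4) :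
    ∫ x, Real.exp (s * x ^ 2) ∂gaussianReal 0 1 ≤ Real.exp (s + 2 * s ^ 2) := by
  rw [integral_exp_sq_gaussianReal (by linarith)]
  have h3 : 0 < 1 - 2 * s := by linarith
  have h4 := one_le_one_sub_mul_exp (x := 2 * s) (by linarith)
  refine inv_le_of_inv_le₀ (Real.exp_pos _) (Real.le_sqrt_of_sq_le ?_)
  rw [← Real.exp_neg, ← Real.exp_nat_mul]
  have h5 : Real.exp (2 * s + (2 * s) ^ 2) * Real.exp (((2 : ℕ) : ℝ) * -(s + 2 * s ^ 2)) = 1 := by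
    rw [← Real.exp_add, Real.exp_eq_one_iff]
    push_cast
    ring
  nlinarith [Real.exp_pos (((2 : ℕ) : ℝ) * -(s + 2 * s ^ 2))]

variable {ι : Type*} [Fintype ι]

theorem integrable_exp_sum_sq {s : ℝ} (hs : s < 1 / 2) :
    Integrable (fun x : ι → ℝ => Real.exp (s * ∑ i, x i ^ 2)) (gaussVec ι) := by
  have h := Integrable.fintype_prod (ι := ι) (f := fun _ (x : ℝ) => Real.exp (s * x ^ 2))
    (μ := fun _ => gaussianReal 0 1) fun _ => integrable_exp_sq_gaussianReal hs
  refine h.congr (.of_forall fun x => ?_)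
  simp only
  rw [← Real.exp_sum, Finset.mul_sum]

theorem mgf_sum_sq_le {s : ℝ} (h2 : s ≤ 1 / 4) :
    mgf (fun x : ι → ℝ => ∑ i, x i ^ 2) (gaussVec ι) s ≤
      Real.exp (Fintype.card ι * (s + 2 * s ^ 2)) := by
  have h : ∀ x : ι → ℝ, Real.exp (s * ∑ i, x i ^ 2) = ∏ i, Real.exp (s * x i ^ 2) := by
    intro x
    rw [← Real.exp_sum, Finset.mul_sum]
  unfold mgf
  simp_rw [h]
  rw [integral_fintype_prod_eq_prod (𝕜 := ℝ) (fun _ (x : ℝ) => Real.exp (s * x ^ 2)),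
    Finset.prod_const, Finset.card_univ, Real.exp_nat_mul]
  exact pow_le_pow_left₀ (integral_nonneg fun x => (Real.exp_pos _).le)
    (integral_exp_sq_gaussianReal_le h2) _

/-- Two-sided tail bound for the chi-square distribution. -/
theorem gaussVec_abs_sum_sq_sub_gt_le {t : ℝ} (ht0 : 0 ≤ t) (ht1 : t ≤ 1) :
    gaussVec ι {x | t * Fintype.card ι < |∑ i, x i ^ 2 - Fintype.card ι|} ≤
      ENNReal.ofReal (2 * Real.exp (-(Fintype.card ι * t ^ 2 / 8))) := by
  set N : ℝ := (Fintype.card ι : ℝ) with hN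
  have hN0 : 0 ≤ N := by positivity
  -- The Chernoff exponent `N(s + 2s²) - sN(1 + t) = N(2s² - st)` is minimal at `s = t/4`, with
  -- value `-Nt²/8`. The lower tail uses `-t/4`.
  have up := measure_ge_le_exp_mul_mgf (X := fun x : ι → ℝ => ∑ i, x i ^ 2) (μ := gaussVec ι)
    (t := t / 4) (N * (1 + t)) (by positivity) (integrable_exp_sum_sq (by linarith))
  have lo := measure_le_le_exp_mul_mgf (X := fun x : ι → ℝ => ∑ i, x i ^ 2) (μ := gaussVec ι)
    (t := -(t / 4)) (N * (1 - t)) (by linarith) (integrable_exp_sum_sq (by linarith))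
  have up' : (gaussVec ι).real {x | N * (1 + t) ≤ ∑ i, x i ^ 2} ≤
      Real.exp (-(N * t ^ 2 / 8)) := by
    refine up.trans ((mul_le_mul_of_nonneg_left (mgf_sum_sq_le (by linarith))
      (Real.exp_pos _).le).trans ?_)
    rw [← Real.exp_add, Real.exp_le_exp, ← hN]
    nlinarith [mul_nonneg hN0 (sq_nonneg t)]
  have lo' : (gaussVec ι).real {x | ∑ i, x i ^ 2 ≤ N * (1 - t)} ≤
      Real.exp (-(N * t ^ 2 / 8)) := by
    refine lo.trans ((mul_le_mul_of_nonneg_left (mgf_sum_sq_le (by linarith))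
      (Real.exp_pos _).le).trans ?_)
    rw [← Real.exp_add, Real.exp_le_exp, ← hN]
    nlinarith [mul_nonneg hN0 (sq_nonneg t)]
  have hsub : {x : ι → ℝ | t * N < |∑ i, x i ^ 2 - N|} ⊆
      {x | N * (1 + t) ≤ ∑ i, x i ^ 2} ∪ {x | ∑ i, x i ^ 2 ≤ N * (1 - t)} := by
    intro x hx
    rcases lt_abs.1 (show t * N < |∑ i, x i ^ 2 - N| from hx) with h | h
    · left
      show N * (1 + t) ≤ _
      linarith
    · right
      show _ ≤ N * (1 - t)
      linarith
  have key : (gaussVec ι).real {x | t * N < |∑ i, x i ^ 2 - N|} ≤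
      2 * Real.exp (-(N * t ^ 2 / 8)) := by
    refine (measureReal_mono hsub).trans ((measureReal_union_le _ _).trans ?_)
    linarith
  rw [← ENNReal.ofReal_toReal (measure_ne_top (gaussVec ι) {x | t * N < |∑ i, x i ^ 2 - N|})]
  exact ENNReal.ofReal_le_ofReal key

/-- Two-sided tail bound for a linear form in a standard Gaussian vector. -/
theorem gaussVec_abs_linear_ge_le {v : ι → ℝ} {ρ c : ℝ} (hρ : 0 < ρ) (hc : 0 ≤ c)
    (hv : ∑ i, v i ^ 2 ≤ ρ ^ 2) :
    gaussVec ι {x | c ≤ |∑ i, v i * x i|} ≤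
      ENNReal.ofReal (2 * Real.exp (-(c ^ 2 / (2 * ρ ^ 2)))) := by
  have hint : ∀ s : ℝ,
      Integrable (fun x : ι → ℝ => Real.exp (s * ∑ i, v i * x i)) (gaussVec ι) := by
    intro s
    have h := Integrable.fintype_prod (ι := ι) (f := fun i (x : ℝ) => Real.exp (s * v i * x))
      (μ := fun _ => gaussianReal 0 1) fun i => integrable_exp_mul_gaussianReal _
    refine h.congr (.of_forall fun x => ?_)
    simp only
    rw [← Real.exp_sum, Finset.mul_sum]
    simp_rw [mul_assoc]
  have hmgf : ∀ s : ℝ, mgf (fun x : ι → ℝ => ∑ i, v i * x i) (gaussVec ι) s ≤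
      Real.exp (s ^ 2 * ρ ^ 2 / 2) := by
    intro s
    have h : ∀ x : ι → ℝ, Real.exp (s * ∑ i, v i * x i) = ∏ i, Real.exp (s * v i * x i) := by
      intro x
      rw [← Real.exp_sum, Finset.mul_sum]
      simp_rw [mul_assoc]
    have h2 : ∀ i, ∫ x, Real.exp (s * v i * x) ∂gaussianReal 0 1 =
        Real.exp (s ^ 2 / 2 * v i ^ 2) := by
      intro i
      have := congrFun (mgf_id_gaussianReal (μ := 0) (v := 1)) (s * v i)
      simp only [mgf, id] at this
      rw [this]
      congr 1
      simp
      ring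
    unfold mgf
    simp_rw [h]
    rw [integral_fintype_prod_eq_prod (𝕜 := ℝ) (fun i (x : ℝ) => Real.exp (s * v i * x))]
    simp_rw [h2]
    rw [← Real.exp_sum, ← Finset.mul_sum, Real.exp_le_exp]
    nlinarith [sq_nonneg s, mul_le_mul_of_nonneg_left hv (sq_nonneg s)]
  -- The exponent `-sc + s²ρ²/2` is minimal at `s = c/ρ²`.
  have e : -(c / ρ ^ 2) * c + (c / ρ ^ 2) ^ 2 * ρ ^ 2 / 2 = -(c ^ 2 / (2 * ρ ^ 2)) := by
    field_simp
    ring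
  have up := measure_ge_le_exp_mul_mgf (X := fun x : ι → ℝ => ∑ i, v i * x i) (μ := gaussVec ι)
    (t := c / ρ ^ 2) c (by positivity) (hint _)
  have lo := measure_le_le_exp_mul_mgf (X := fun x : ι → ℝ => ∑ i, v i * x i) (μ := gaussVec ι)
    (t := -(c / ρ ^ 2)) (-c) (by rw [neg_nonpos]; positivity) (hint _)
  have up' := up.trans (mul_le_mul_of_nonneg_left (hmgf _) (Real.exp_pos _).le)
  have lo' := lo.trans (mul_le_mul_of_nonneg_left (hmgf _) (Real.exp_pos _).le)
  rw [← Real.exp_add, e] at up'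
  rw [← Real.exp_add, neg_neg, neg_sq, mul_neg, ← neg_mul, e] at lo'
  have key : (gaussVec ι).real {x | c ≤ |∑ i, v i * x i|} ≤
      2 * Real.exp (-(c ^ 2 / (2 * ρ ^ 2))) := by
    have hsub : {x : ι → ℝ | c ≤ |∑ i, v i * x i|} ⊆
        {x | c ≤ ∑ i, v i * x i} ∪ {x | ∑ i, v i * x i ≤ -c} := by
      intro x hx
      rcases le_abs.1 (show c ≤ |∑ i, v i * x i| from hx) with h | h
      · exact Or.inl h
      · right
        show _ ≤ -c
        linarith
    refine (measureReal_mono hsub).trans ((measureReal_union_le _ _).trans ?_)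
    linarith
  rw [← ENNReal.ofReal_toReal (measure_ne_top (gaussVec ι) {x | c ≤ |∑ i, v i * x i|})]
  exact ENNReal.ofReal_le_ofReal key

end Tails

/-! ### Nets of the sphere and quadratic forms -/

section Nets

open Metric Module

variable {E : Type*} [NormedAddCommGroup E] [InnerProductSpace ℝ E] [FiniteDimensional ℝ E]

/-- Volume comparison: the balls of radius `1/8` around the points are disjoint and lie in the ball
of radius `9/8`. -/
theorem card_le_nine_pow_of_separated (s : Finset E) (hs : ∀ c ∈ s, ‖c‖ = 1)
    (h : ∀ c ∈ s, ∀ d ∈ s, c ≠ d → 1 / 4 ≤ ‖c - d‖) : s.card ≤ 9 ^ finrank ℝ E := by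
  borelize E
  let μ : Measure E := Measure.addHaar
  let δ : ℝ := (1 : ℝ) / 8
  let ρ : ℝ := (9 : ℝ) / 8
  have ρpos : 0 < ρ := by norm_num [ρ]
  have δpos : 0 < δ := by norm_num [δ]
  set A := ⋃ c ∈ s, ball (c : E) δ with hA
  have D : Set.Pairwise (s : Set E) (Function.onFun Disjoint fun c => ball (c : E) δ) := by
    rintro c hc d hd hcd
    apply ball_disjoint_ball
    rw [dist_eq_norm]
    have := h c hc d hd hcd
    norm_num [δ]
    linarith
  have A_subset : A ⊆ ball (0 : E) ρ := by
    refine Set.iUnion₂_subset fun x hx => ?_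
    apply ball_subset_ball'
    rw [dist_zero_right, hs x hx]
    norm_num [δ, ρ]
  have I : (s.card : ENNReal) * ENNReal.ofReal (δ ^ finrank ℝ E) * μ (ball 0 1) ≤
      ENNReal.ofReal (ρ ^ finrank ℝ E) * μ (ball 0 1) :=
    calc
      (s.card : ENNReal) * ENNReal.ofReal (δ ^ finrank ℝ E) * μ (ball 0 1) = μ A := by
        rw [hA, measure_biUnion_finset D fun c _ => measurableSet_ball]
        simp only [μ.addHaar_ball_of_pos _ δpos]
        simp only [Finset.sum_const, nsmul_eq_mul, mul_assoc]
      _ ≤ μ (ball (0 : E) ρ) := measure_mono A_subset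
      _ = ENNReal.ofReal (ρ ^ finrank ℝ E) * μ (ball 0 1) := by
        simp only [μ.addHaar_ball_of_pos _ ρpos]
  have J : (s.card : ENNReal) * ENNReal.ofReal (δ ^ finrank ℝ E) ≤
      ENNReal.ofReal (ρ ^ finrank ℝ E) :=
    (ENNReal.mul_le_mul_iff_left (measure_ball_pos _ _ zero_lt_one).ne'
      measure_ball_lt_top.ne).1 I
  have K : (s.card : ℝ) ≤ (9 : ℝ) ^ finrank ℝ E := by
    have := ENNReal.toReal_le_of_le_ofReal (pow_nonneg ρpos.le _) J
    rw [ENNReal.toReal_mul, ENNReal.toReal_natCast,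
      ENNReal.toReal_ofReal (pow_nonneg δpos.le _)] at this
    have e : ρ ^ finrank ℝ E = 9 ^ finrank ℝ E * δ ^ finrank ℝ E := by
      rw [← mul_pow]
      norm_num [ρ, δ]
    rw [e] at this
    exact le_of_mul_le_mul_right this (pow_pos δpos _)
  exact_mod_cast K

/-- The unit sphere has a `1 / 4`-net of at most `9 ^ d` points. -/
theorem exists_sphere_net : ∃ N : Finset E, N.card ≤ 9 ^ finrank ℝ E ∧ (∀ y ∈ N, ‖y‖ = 1) ∧
    ∀ x : E, ‖x‖ = 1 → ∃ y ∈ N, ‖x - y‖ ≤ 1 / 4 := by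
  classical
  -- A `1/4`-separated set of maximal cardinality is a net, since a point far from all its elements
  -- could be added.
  let Q : ℕ → Prop := fun m => ∃ s : Finset E, s.card = m ∧ (∀ c ∈ s, ‖c‖ = 1) ∧
    ∀ c ∈ s, ∀ d ∈ s, c ≠ d → 1 / 4 ≤ ‖c - d‖
  have hQ0 : Q 0 := ⟨∅, by simp⟩
  have hbound : ∀ m, Q m → m ≤ 9 ^ finrank ℝ E := by
    rintro m ⟨s, rfl, h1, h2⟩
    exact card_le_nine_pow_of_separated s h1 h2
  obtain ⟨s, hcard, h1, h2⟩ : Q (Nat.findGreatest Q (9 ^ finrank ℝ E)) :=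
    Nat.findGreatest_spec (Nat.zero_le _) hQ0
  refine ⟨s, hcard ▸ Nat.findGreatest_le _, h1, fun x hx => ?_⟩
  by_contra! hfar
  have hxs : x ∉ s := fun hxs => by
    have := hfar x hxs
    simp at this
    linarith
  have hQ : Q (s.card + 1) := by
    refine ⟨insert x s, Finset.card_insert_of_notMem hxs, ?_, ?_⟩
    · intro c hc
      rcases Finset.mem_insert.1 hc with rfl | hc
      · exact hx
      · exact h1 c hc
    · intro c hc d hd hcd
      rcases Finset.mem_insert.1 hc with hc' | hc' <;>
        rcases Finset.mem_insert.1 hd with hd' | hd'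
      · exact absurd (hc'.trans hd'.symm) hcd
      · exact hc' ▸ (hfar d hd').le
      · rw [norm_sub_rev]
        exact hd' ▸ (hfar c hc').le
      · exact h2 c hc' d hd' hcd
  have := Nat.le_findGreatest (hbound _ hQ) hQ
  omega

/-- A continuous quadratic function that is at most `t` on a `1 / 4`-net of the unit sphere
is at most `2 t` on the sphere. -/
theorem abs_quadratic_le_of_net {q : E → ℝ} (hcont : Continuous q)
    (hsmul : ∀ (c : ℝ) x, q (c • x) = c ^ 2 * q x)
    (hpol : ∀ x y, 32 * (q x - q y) = q ((9 : ℝ) • x - (7 : ℝ) • y) - q ((7 : ℝ) • x - (9 : ℝ) • y))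
    {N : Finset E} (hN1 : ∀ y ∈ N, ‖y‖ = 1)
    (hN : ∀ x : E, ‖x‖ = 1 → ∃ y ∈ N, ‖x - y‖ ≤ 1 / 4) {t : ℝ} (ht : ∀ y ∈ N, |q y| ≤ t) (x : E) :
    |q x| ≤ 2 * t * ‖x‖ ^ 2 := by
  rcases eq_or_ne x 0 with rfl | hx
  · have := hsmul 0 0
    simp at this
    simp [this]
  have hne : (sphere (0 : E) 1).Nonempty := by
    refine ⟨‖x‖⁻¹ • x, ?_⟩
    rw [mem_sphere_zero_iff_norm, norm_smul, norm_inv, norm_norm,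
      inv_mul_cancel₀ (norm_ne_zero_iff.2 hx)]
  obtain ⟨x0, hx0, hmax⟩ := (isCompact_sphere (0 : E) 1).exists_isMaxOn hne
    (hcont.abs.continuousOn)
  rw [mem_sphere_zero_iff_norm] at hx0
  have hM : ∀ z : E, |q z| ≤ |q x0| * ‖z‖ ^ 2 := by
    intro z
    rcases eq_or_ne z 0 with rfl | hz
    · have := hsmul 0 0
      simp at this
      simp [this]
    · have hz' : ‖z‖ ≠ 0 := norm_ne_zero_iff.2 hz
      have h1 : |q (‖z‖⁻¹ • z)| ≤ |q x0| := by
        refine hmax ?_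
        rw [mem_sphere_zero_iff_norm, norm_smul, norm_inv, norm_norm, inv_mul_cancel₀ hz']
      rw [hsmul, abs_mul, abs_of_nonneg (sq_nonneg (‖z‖⁻¹))] at h1
      have h2 : 0 < ‖z‖ ^ 2 := by positivity
      calc |q z| = ((‖z‖⁻¹) ^ 2 * |q z|) * ‖z‖ ^ 2 := by field_simp
        _ ≤ _ := mul_le_mul_of_nonneg_right h1 h2.le
  obtain ⟨y, hy, hxy⟩ := hN x0 hx0
  have hy1 := hN1 y hy
  -- Polarization with balanced weights: the arguments are `8(x₀ - y) ± (x₀ + y)`, and `8‖x₀ - y‖`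
  -- and `‖x₀ + y‖` are both at most `2`. The squared norms therefore sum to at most `16`, so `q`
  -- changes from the maximizer `x₀` to `y` by at most half of the maximum.
  have h3 := hpol x0 y
  have h4 := hM ((9 : ℝ) • x0 - (7 : ℝ) • y)
  have h5 := hM ((7 : ℝ) • x0 - (9 : ℝ) • y)
  have h6 : ‖x0 - y‖ ^ 2 ≤ 1 / 16 := by nlinarith [norm_nonneg (x0 - y)]
  have h7 := norm_sub_sq_real x0 y
  have h8 := norm_sub_sq_real ((9 : ℝ) • x0) ((7 : ℝ) • y)
  have h9 := norm_sub_sq_real ((7 : ℝ) • x0) ((9 : ℝ) • y)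
  simp only [norm_smul, real_inner_smul_left, real_inner_smul_right, hx0, hy1, Real.norm_eq_abs]
    at h7 h8 h9
  norm_num at h7 h8 h9
  have h10 : ‖(9 : ℝ) • x0 - (7 : ℝ) • y‖ ^ 2 + ‖(7 : ℝ) • x0 - (9 : ℝ) • y‖ ^ 2 ≤ 16 := by
    rw [h8, h9]
    linarith
  have h11 : |q x0 - q y| ≤ |q x0| / 2 := by
    have h12 : 32 * |q x0 - q y| ≤ |q x0| * 16 := by
      rw [← abs_of_nonneg (show (0 : ℝ) ≤ 32 by norm_num), ← abs_mul, h3]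
      refine (abs_sub _ _).trans ?_
      have := mul_le_mul_of_nonneg_left h10 (abs_nonneg (q x0))
      linarith
    linarith
  have h13 : |q x0| ≤ 2 * t := by
    have h14 := ht y hy
    have h15 := abs_sub_abs_le_abs_sub (q x0) (q y)
    linarith
  exact (hM x).trans (mul_le_mul_of_nonneg_right h13 (sq_nonneg _))

end Nets

/-! ### Restricted isometry of the Gaussian design -/

section RestrictedIsometry

variable {n p : ℕ}

/-- `X` restricted to the columns in `A` is, after normalization, an isometry up to `Δ`. -/
def RestrictedIsometry (X : Fin n → Fin p → ℝ) (A : Finset (Fin p)) (Δ : ℝ) : Prop :=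
  ∀ h : Fin p → ℝ, (∀ j ∉ A, h j = 0) →
    |∑ i, (∑ j, X i j * h j) ^ 2 - n * ∑ j, h j ^ 2| ≤ Δ * n * ∑ j, h j ^ 2

theorem RestrictedIsometry.mono {X : Fin n → Fin p → ℝ} {A B : Finset (Fin p)} {Δ : ℝ}
    (h : RestrictedIsometry X B Δ) (hAB : A ⊆ B) : RestrictedIsometry X A Δ :=
  fun v hv => h v fun j hj => hv j fun hjA => hj (hAB hjA)

/-- The net bound is applied to `‖Xh‖² - n‖h‖²` on vectors supported in `A`. The net depends on `A`
only and not on `X`, which permits a union bound over its points. -/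
theorem exists_restrictedIsometry_net (A : Finset (Fin p)) :
    ∃ N : Finset (Fin p → ℝ), N.card ≤ 9 ^ A.card ∧ (∀ y ∈ N, ∑ j, y j ^ 2 = 1) ∧
      ∀ (n : ℕ) (X : Fin n → Fin p → ℝ) (t : ℝ),
        (∀ y ∈ N, |∑ i, (∑ j, X i j * y j) ^ 2 - n| ≤ t * n) → RestrictedIsometry X A (2 * t) := by
  classical
  obtain ⟨N, hcard, hN1, hN⟩ := exists_sphere_net (E := EuclideanSpace ℝ {j // j ∈ A})
  let ext : EuclideanSpace ℝ {j // j ∈ A} → Fin p → ℝ := fun x j => if h : j ∈ A then x ⟨j, h⟩ else 0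
  have hsum : ∀ (g : Fin p → ℝ → ℝ), (∀ j, g j 0 = 0) → ∀ x : EuclideanSpace ℝ {j // j ∈ A},
      ∑ j, g j (ext x j) = ∑ a : {j // j ∈ A}, g a (x a) := by
    intro g hg x
    rw [← Finset.sum_subset (Finset.subset_univ A), ← Finset.sum_attach, Finset.univ_eq_attach]
    · refine Finset.sum_congr rfl fun a _ => ?_
      simp [ext]
    · intro j _ hj
      simp [ext, hj, hg]
  have hnorm : ∀ x : EuclideanSpace ℝ {j // j ∈ A}, ∑ j, ext x j ^ 2 = ‖x‖ ^ 2 := by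
    intro x
    rw [hsum (fun _ c => c ^ 2) (by simp), EuclideanSpace.norm_sq_eq]
    simp
  refine ⟨N.image ext, Finset.card_image_le.trans (hcard.trans_eq (by simp)), ?_, ?_⟩
  · intro y hy
    obtain ⟨x, hx, rfl⟩ := Finset.mem_image.1 hy
    rw [hnorm, hN1 x hx, one_pow]
  intro n X t ht h hh
  let q : EuclideanSpace ℝ {j // j ∈ A} → ℝ := fun x => ∑ i, (∑ a : {j // j ∈ A}, X i a * x a) ^ 2 - n * ∑ a, x a ^ 2
  have hq : ∀ x : EuclideanSpace ℝ {j // j ∈ A}, q x = ∑ i, (∑ j, X i j * ext x j) ^ 2 - n * ‖x‖ ^ 2 := by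
    intro x
    simp only [q]
    congr 1
    · refine Finset.sum_congr rfl fun i _ => ?_
      rw [hsum (fun j c => X i j * c) (by simp)]
    · rw [EuclideanSpace.norm_sq_eq]
      simp
  have hlin : ∀ (i : Fin n) (c d : ℝ) (x y : EuclideanSpace ℝ {j // j ∈ A}), ∑ a : {j // j ∈ A}, X i a * (c • x - d • y) a =
      c * ∑ a : {j // j ∈ A}, X i a * x a - d * ∑ a : {j // j ∈ A}, X i a * y a := by
    intro i c d x y
    rw [Finset.mul_sum, Finset.mul_sum, ← Finset.sum_sub_distrib]
    refine Finset.sum_congr rfl fun a _ => ?_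
    simp
    ring
  have hcont : Continuous q := by
    simp only [q]
    fun_prop
  have hsmul : ∀ (c : ℝ) (x : EuclideanSpace ℝ {j // j ∈ A}), q (c • x) = c ^ 2 * q x := by
    intro c x
    have h1 := fun i => hlin i c 0 x x
    simp only [zero_smul, sub_zero, zero_mul] at h1
    simp only [q, h1]
    simp only [mul_pow, PiLp.smul_apply, smul_eq_mul, ← Finset.mul_sum]
    ring
  have hpol : ∀ x y : EuclideanSpace ℝ {j // j ∈ A}, 32 * (q x - q y) =
      q ((9 : ℝ) • x - (7 : ℝ) • y) - q ((7 : ℝ) • x - (9 : ℝ) • y) := by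
    intro x y
    simp only [q, hlin]
    have h1 : ∀ {κ : Type} [Fintype κ] (a b : κ → ℝ),
        32 * (∑ i, a i ^ 2 - ∑ i, b i ^ 2) =
        ∑ i, (9 * a i - 7 * b i) ^ 2 - ∑ i, (7 * a i - 9 * b i) ^ 2 := by
      intro κ _ a b
      rw [← Finset.sum_sub_distrib, ← Finset.sum_sub_distrib, Finset.mul_sum]
      exact Finset.sum_congr rfl fun i _ => by ring
    have h2 := h1 (fun i => ∑ a : {j // j ∈ A}, X i a * x a)
      fun i => ∑ a : {j // j ∈ A}, X i a * y a
    have h3 := h1 (fun a : {j // j ∈ A} => x a) fun a => y a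
    simp only [PiLp.sub_apply, PiLp.smul_apply, smul_eq_mul]
    linear_combination h2 - n * h3
  let x : EuclideanSpace ℝ {j // j ∈ A} := WithLp.toLp 2 fun a => h a
  have hx : ext x = h := by
    ext j
    by_cases hj : j ∈ A
    · simp [ext, x, hj]
    · simp [ext, hj, hh j hj]
  have key := abs_quadratic_le_of_net hcont hsmul hpol hN1 hN (t := t * n) (fun y hy => by
    rw [hq, hN1 y hy, one_pow, mul_one]
    exact ht _ (Finset.mem_image_of_mem _ hy)) x
  rw [hq, hx, ← hnorm x, hx] at key
  linarith

/-- Uniform restricted isometry of a Gaussian matrix. -/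
theorem gaussMat_not_restrictedIsometry_le (n p m : ℕ) {t : ℝ} (ht0 : 0 ≤ t) (ht1 : t ≤ 1) :
    gaussMat (Fin n) (Fin p)
      {X | ¬ ∀ A : Finset (Fin p), A.card = m → RestrictedIsometry X A (2 * t)} ≤
      (p.choose m * 9 ^ m : ℕ) * ENNReal.ofReal (2 * Real.exp (-(n * t ^ 2 / 8))) := by
  classical
  choose N hcard hN1 hN using fun A : Finset (Fin p) => exists_restrictedIsometry_net A
  set bound := ENNReal.ofReal (2 * Real.exp (-(n * t ^ 2 / 8))) with hbound
  have hone : ∀ y : Fin p → ℝ, ∑ j, y j ^ 2 = 1 → gaussMat (Fin n) (Fin p)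
      {X | t * n < |∑ i, (∑ j, X i j * y j) ^ 2 - n|} ≤ bound := by
    intro y hy
    have h1 := gaussVec_abs_sum_sq_sub_gt_le (ι := Fin n) ht0 ht1
    rw [← gaussMat_map_mulVec (ι := Fin n) y hy, Measure.map_apply (by fun_prop)] at h1
    · rw [Fintype.card_fin] at h1
      exact h1
    · refine measurableSet_lt (by fun_prop) (by fun_prop)
  have hsub : {X : Fin n → Fin p → ℝ |
      ¬ ∀ A : Finset (Fin p), A.card = m → RestrictedIsometry X A (2 * t)} ⊆
      ⋃ A ∈ Finset.univ.powersetCard m, ⋃ y ∈ N A,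
        {X | t * n < |∑ i, (∑ j, X i j * y j) ^ 2 - n|} := by
    intro X hX
    simp only [Set.mem_ofPred_eq, not_forall] at hX
    obtain ⟨A, hA, hX⟩ := hX
    have h1 : ¬ ∀ y ∈ N A, |∑ i, (∑ j, X i j * y j) ^ 2 - n| ≤ t * n := fun h1 =>
      hX (hN A n X t h1)
    push Not at h1
    obtain ⟨y, hy, h1⟩ := h1
    simp only [Set.mem_iUnion]
    exact ⟨A, Finset.mem_powersetCard_univ.2 hA, y, hy, h1⟩
  refine (measure_mono hsub).trans ((measure_biUnion_finset_le _ _).trans ?_)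
  have hA : ∀ A ∈ (Finset.univ : Finset (Fin p)).powersetCard m, gaussMat (Fin n) (Fin p)
      (⋃ y ∈ N A, {X | t * n < |∑ i, (∑ j, X i j * y j) ^ 2 - n|}) ≤ (9 ^ m : ℕ) * bound := by
    intro A hA
    refine (measure_biUnion_finset_le _ _).trans ?_
    refine (Finset.sum_le_card_nsmul _ _ bound fun y hy => hone y (hN1 A y hy)).trans ?_
    rw [nsmul_eq_mul]
    gcongr
    exact (hcard A).trans_eq (by rw [Finset.mem_powersetCard_univ.1 hA])
  refine (Finset.sum_le_card_nsmul _ _ _ hA).trans ?_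
  rw [Finset.card_powersetCard, Finset.card_univ, Fintype.card_fin, nsmul_eq_mul, ← mul_assoc]
  push_cast
  rfl

/-- For an eigenvector `v`, extended by zero, `‖Xv‖² = n t ‖v‖²`, so restricted isometry reads `|t -
1| ≤ Δ`. -/
theorem RestrictedIsometry.hasEigenvalue_gram {X : Fin n → Fin p → ℝ} {A : Finset (Fin p)} {Δ : ℝ}
    (hn : 0 < n) (h : RestrictedIsometry X A Δ) {t : ℝ}
    (ht : Module.End.HasEigenvalue (Matrix.toLin' (gram (Matrix.of X) A)) t) :
    t ∈ Set.Icc (1 - Δ) (1 + Δ) := by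
  classical
  obtain ⟨v, hv⟩ := ht.exists_hasEigenvector
  have hv0 := hv.2
  have hvt : (gram (Matrix.of X) A).mulVec v = t • v := by
    rw [← Matrix.toLin'_apply]
    exact hv.apply_eq_smul
  let e : Fin p → ℝ := fun j => if h : j ∈ A then v ⟨j, h⟩ else 0
  have hsum : ∀ (g : Fin p → ℝ → ℝ), (∀ j, g j 0 = 0) →
      ∑ j, g j (e j) = ∑ a : {j // j ∈ A}, g a (v a) := by
    intro g hg
    rw [← Finset.sum_subset (Finset.subset_univ A), ← Finset.sum_attach, Finset.univ_eq_attach]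
    · refine Finset.sum_congr rfl fun a _ => ?_
      simp [e]
    · intro j _ hj
      simp [e, hj, hg]
  have h1 := h e fun j hj => by simp [e, hj]
  have h2 : ∑ j, e j ^ 2 = ∑ a, v a ^ 2 := hsum (fun _ c => c ^ 2) (by simp)
  have h3 : ∑ i, (∑ j, X i j * e j) ^ 2 = n * (t * ∑ a, v a ^ 2) := by
    have h4 : v ⬝ᵥ (gram (Matrix.of X) A).mulVec v = t * ∑ a, v a ^ 2 := by
      rw [hvt, dotProduct_smul, smul_eq_mul]
      simp [dotProduct, sq]
    have h5 : v ⬝ᵥ (gram (Matrix.of X) A).mulVec v =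
        (n : ℝ)⁻¹ * ∑ i, (∑ j, X i j * e j) ^ 2 := by
      rw [gram, Matrix.smul_mulVec, dotProduct_smul, smul_eq_mul, ← Matrix.mulVec_mulVec,
        Matrix.dotProduct_mulVec, Matrix.vecMul_transpose]
      congr 1
      simp only [dotProduct, Matrix.mulVec, Matrix.submatrix_apply, Matrix.of_apply, id, ← sq]
      refine Finset.sum_congr rfl fun i _ => ?_
      rw [hsum (fun j c => X i j * c) (by simp)]
    rw [← h4, h5, ← mul_assoc, mul_inv_cancel₀ (by positivity), one_mul]
  have hpos : 0 < (n : ℝ) * ∑ a, v a ^ 2 := by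
    have : 0 < ∑ a, v a ^ 2 := by
      obtain ⟨a, ha⟩ := Function.ne_iff.1 hv0
      exact Finset.sum_pos' (fun a _ => sq_nonneg _)
        ⟨a, Finset.mem_univ a, by have : v a ≠ 0 := ha; positivity⟩
    have hn' : (0 : ℝ) < n := by exact_mod_cast hn
    positivity
  rw [h2, h3] at h1
  have h6 : |(t - 1) * (n * ∑ a, v a ^ 2)| ≤ Δ * (n * ∑ a, v a ^ 2) := by
    rw [show (t - 1) * (n * ∑ a, v a ^ 2) = n * (t * ∑ a, v a ^ 2) - n * ∑ a, v a ^ 2 by ring,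
      ← mul_assoc Δ]
    exact h1
  rw [abs_mul, abs_of_pos hpos] at h6
  have h7 := abs_le.1 (le_of_mul_le_mul_right h6 hpos)
  exact ⟨by linarith [h7.1], by linarith [h7.2]⟩

end RestrictedIsometry

/-! ### Deterministic analysis of the Lasso -/

section Deterministic

variable {n p : ℕ}

theorem mulVec_eq_sum (X : Matrix (Fin n) (Fin p) ℝ) (b : Fin p → ℝ) (i : Fin n) :
    X.mulVec b i = ∑ j, X i j * b j := rfl

theorem transpose_mulVec_eq_sum (X : Matrix (Fin n) (Fin p) ℝ) (z : Fin n → ℝ) (j : Fin p) :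
    X.transpose.mulVec z j = ∑ i, X i j * z i := rfl

theorem nonpos_of_forall_le_mul {G K : ℝ} (hK : 0 ≤ K)
    (h : ∀ t : ℝ, 0 < t → t ≤ 1 → G ≤ t * K) : G ≤ 0 := by
  by_contra! hG
  have h1 := h (G / (G + K)) (by positivity) ((div_le_one (by positivity)).2 (by linarith))
  rw [div_mul_eq_mul_div, le_div_iff₀ (by positivity)] at h1
  nlinarith

/-- First order optimality of a Lasso estimator. -/
theorem IsLasso.inner_residual_le (hn : 0 < n) {X : Matrix (Fin n) (Fin p) ℝ} {y : Fin n → ℝ}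
    {lam : ℝ} (hlam : 0 ≤ lam) {b : Fin p → ℝ} (hb : IsLasso X y lam b) (d : Fin p → ℝ) :
    1 / (n : ℝ) * ∑ i, (y i - X.mulVec b i) * X.mulVec d i ≤
      lam * (∑ j, |b j + d j| - ∑ j, |b j|) := by
  have hn' : (0 : ℝ) < n := by exact_mod_cast hn
  rw [← sub_nonpos]
  -- The objective at `b` is compared with that at `b + t d`. Convexity makes the penalty increment
  -- at most linear in `t`, and after division by `t` the quadratic term vanishes as `t → 0`.
  refine nonpos_of_forall_le_mul (K := 1 / (2 * (n : ℝ)) * ∑ i, X.mulVec d i ^ 2)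
    (by positivity) fun t ht0 ht1 => ?_
  have h1 := hb (b + t • d)
  unfold lassoObjective at h1
  have e1 : ∑ i, (y i - X.mulVec (b + t • d) i) ^ 2 = ∑ i, (y i - X.mulVec b i) ^ 2 -
      2 * t * ∑ i, (y i - X.mulVec b i) * X.mulVec d i + t ^ 2 * ∑ i, X.mulVec d i ^ 2 := by
    rw [Finset.mul_sum, Finset.mul_sum, ← Finset.sum_sub_distrib, ← Finset.sum_add_distrib]
    refine Finset.sum_congr rfl fun i _ => ?_
    rw [Matrix.mulVec_add, Matrix.mulVec_smul]
    simp only [Pi.add_apply, Pi.smul_apply, smul_eq_mul]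
    ring
  have e2 : ∑ j, |(b + t • d) j| ≤ ∑ j, |b j| + t * (∑ j, |b j + d j| - ∑ j, |b j|) := by
    rw [← Finset.sum_sub_distrib, Finset.mul_sum, ← Finset.sum_add_distrib]
    refine Finset.sum_le_sum fun j _ => ?_
    have : (b + t • d) j = (1 - t) * b j + t * (b j + d j) := by
      simp only [Pi.add_apply, Pi.smul_apply, smul_eq_mul]
      ring
    rw [this]
    refine (abs_add_le _ _).trans (le_of_eq ?_)
    rw [abs_mul, abs_mul, abs_of_pos ht0, abs_of_nonneg (by linarith : 0 ≤ 1 - t)]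
    ring
  rw [e1] at h1
  have h2 := mul_le_mul_of_nonneg_left e2 hlam
  set R := ∑ i, (y i - X.mulVec b i) * X.mulVec d i
  set D := ∑ i, X.mulVec d i ^ 2
  set Q := ∑ i, (y i - X.mulVec b i) ^ 2
  set A := ∑ j, |b j + d j| - ∑ j, |b j|
  have h3 : t * (1 / (n : ℝ) * R - lam * A) ≤ t * (t * (1 / (2 * (n : ℝ)) * D)) := by
    have e3 : 1 / (2 * (n : ℝ)) * (Q - 2 * t * R + t ^ 2 * D) =
        1 / (2 * (n : ℝ)) * Q - t * (1 / (n : ℝ) * R) + t * (t * (1 / (2 * (n : ℝ)) * D)) := by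
      field_simp
    rw [e3] at h1
    nlinarith
  exact le_of_mul_le_mul_left h3 ht0

/-- The fitted values of the Lasso are unique. -/
theorem IsLasso.mulVec_eq (hn : 0 < n) {X : Matrix (Fin n) (Fin p) ℝ} {y : Fin n → ℝ}
    {lam : ℝ} (hlam : 0 ≤ lam) {b b' : Fin p → ℝ} (hb : IsLasso X y lam b)
    (hb' : IsLasso X y lam b') : X.mulVec b = X.mulVec b' := by
  have hn' : (0 : ℝ) < n := by exact_mod_cast hn
  -- Each minimizer is tested in the direction of the other. On adding, the penalties cancel and the
  -- squared distance of the fits remains.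
  have h1 := hb.inner_residual_le hn hlam (b' - b)
  have h2 := hb'.inner_residual_le hn hlam (b - b')
  simp only [Pi.sub_apply, add_sub_cancel, Matrix.mulVec_sub] at h1 h2
  have h3 : 1 / (n : ℝ) * ∑ i, (X.mulVec b i - X.mulVec b' i) ^ 2 ≤ 0 := by
    have e : ∑ i, (X.mulVec b i - X.mulVec b' i) ^ 2 =
        ∑ i, (y i - X.mulVec b i) * (X.mulVec b' i - X.mulVec b i) +
        ∑ i, (y i - X.mulVec b' i) * (X.mulVec b i - X.mulVec b' i) := by
      rw [← Finset.sum_add_distrib]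
      exact Finset.sum_congr rfl fun i _ => by ring
    rw [e]
    linarith
  have h4 : ∑ i, (X.mulVec b i - X.mulVec b' i) ^ 2 ≤ 0 :=
    nonpos_of_mul_nonpos_right h3 (by positivity)
  have h5 := (Finset.sum_eq_zero_iff_of_nonneg fun i _ => sq_nonneg _).1
    (le_antisymm h4 (Finset.sum_nonneg fun i _ => sq_nonneg _))
  funext i
  exact sub_eq_zero.1 (pow_eq_zero_iff two_ne_zero |>.1 (h5 i (Finset.mem_univ i)))

/-- The matrix `X` with the columns outside `T` set to zero. -/
def restrictCols (X : Matrix (Fin n) (Fin p) ℝ) (T : Finset (Fin p)) :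
    Matrix (Fin n) (Fin p) ℝ :=
  Matrix.of fun i j => if j ∈ T then X i j else 0

theorem restrictCols_mulVec (X : Matrix (Fin n) (Fin p) ℝ) (T : Finset (Fin p)) (b : Fin p → ℝ) :
    (restrictCols X T).mulVec b = X.mulVec fun j => if j ∈ T then b j else 0 := by
  funext i
  rw [mulVec_eq_sum, mulVec_eq_sum]
  refine Finset.sum_congr rfl fun j _ => ?_
  simp only [restrictCols, Matrix.of_apply]
  split_ifs <;> simp

theorem restrictCols_mulVec_of_support (X : Matrix (Fin n) (Fin p) ℝ) {T : Finset (Fin p)}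
    {b : Fin p → ℝ} (hb : ∀ j ∉ T, b j = 0) : (restrictCols X T).mulVec b = X.mulVec b := by
  rw [restrictCols_mulVec]
  congr 1
  funext j
  split_ifs with h
  · rfl
  · exact (hb j h).symm

/-- Setting the coordinates outside `T` to zero leaves the fit unchanged and lowers the penalty. -/
theorem IsLasso.eq_zero_of_restrictCols (hn : 0 < n) {X : Matrix (Fin n) (Fin p) ℝ}
    {y : Fin n → ℝ} {lam : ℝ} (hlam : 0 < lam) {T : Finset (Fin p)} {b : Fin p → ℝ}
    (hb : IsLasso (restrictCols X T) y lam b) : ∀ j ∉ T, b j = 0 := by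
  have h1 := hb.inner_residual_le hn hlam.le fun j => if j ∈ T then 0 else -b j
  have h2 : (restrictCols X T).mulVec (fun j => if j ∈ T then 0 else -b j) = 0 := by
    rw [restrictCols_mulVec]
    convert Matrix.mulVec_zero X using 2
    funext j
    by_cases hj : j ∈ T <;> simp [hj]
  rw [h2, ← Finset.sum_sub_distrib] at h1
  simp only [Pi.zero_apply, mul_zero, Finset.sum_const_zero] at h1
  have h3 : 0 ≤ ∑ j, (|b j + if j ∈ T then 0 else -b j| - |b j|) :=
    nonneg_of_mul_nonneg_right h1 hlam
  have h4 : ∀ j, |b j + if j ∈ T then 0 else -b j| - |b j| ≤ 0 := by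
    intro j
    split_ifs <;> simp
  have h5 := (Finset.sum_eq_zero_iff_of_nonpos fun j _ => h4 j).1
    (le_antisymm (Finset.sum_nonpos fun j _ => h4 j) h3)
  intro j hj
  have := h5 j (Finset.mem_univ j)
  simpa [hj] using this

/-- Prediction error of the Lasso restricted to the columns in `T ⊇ supp β`. -/
theorem IsLasso.prediction_error_le (hn : 0 < n) {X : Matrix (Fin n) (Fin p) ℝ}
    {z : Fin n → ℝ} {lam : ℝ} (hlam : 0 < lam) {T : Finset (Fin p)} {b β : Fin p → ℝ}
    (hβ : ∀ j ∉ T, β j = 0) (hb : IsLasso (restrictCols X T) (X.mulVec β + z) lam b)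
    {W K : ℝ} (hW0 : 0 ≤ W) (hW : ∑ j ∈ T, (X.transpose.mulVec z j) ^ 2 ≤ W ^ 2)
    (hK : (T.card : ℝ) ≤ K) (hRIP : RestrictedIsometry X T (1 / 2)) :
    ∑ i, X.mulVec (b - β) i ^ 2 ≤ 2 / n * (W + n * lam * √K) ^ 2 := by
  have hn' : (0 : ℝ) < n := by exact_mod_cast hn
  have hb0 := hb.eq_zero_of_restrictCols hn hlam
  set h : Fin p → ℝ := b - β with hh
  have hh0 : ∀ j ∉ T, h j = 0 := fun j hj => by simp [hh, hb0 j hj, hβ j hj]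
  have h1 := hb.inner_residual_le hn hlam.le (β - b)
  have hsupp : ∀ j ∉ T, (β - b) j = 0 := fun j hj => by simp [hb0 j hj, hβ j hj]
  rw [restrictCols_mulVec_of_support X hb0, restrictCols_mulVec_of_support X hsupp] at h1
  set g := ∑ i, X.mulVec h i ^ 2 with hg
  have hg0 : 0 ≤ g := Finset.sum_nonneg fun i _ => sq_nonneg _
  set H := ∑ j, h j ^ 2 with hH
  have hH0 : 0 ≤ H := Finset.sum_nonneg fun i _ => sq_nonneg _
  have hHT : ∑ j ∈ T, h j ^ 2 = H :=
    Finset.sum_subset (Finset.subset_univ T) fun j _ hj => by simp [hh0 j hj]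
  -- Optimality in the direction `β - b` is the basic inequality. The noise enters only through
  -- `X_Tᵀz`, whose norm is at most `W`.
  have e1 : ∑ i, ((X.mulVec β + z) i - X.mulVec b i) * X.mulVec (β - b) i =
      g - ∑ j ∈ T, h j * X.transpose.mulVec z j := by
    have e2 : ∑ j ∈ T, h j * X.transpose.mulVec z j = ∑ i, z i * X.mulVec h i := by
      rw [Finset.sum_subset (Finset.subset_univ T) fun j _ hj => by simp [hh0 j hj]]
      simp_rw [transpose_mulVec_eq_sum, mulVec_eq_sum, Finset.mul_sum]
      rw [Finset.sum_comm]
      exact Finset.sum_congr rfl fun i _ => Finset.sum_congr rfl fun j _ => by ring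
    rw [e2, hg, ← Finset.sum_sub_distrib]
    refine Finset.sum_congr rfl fun i _ => ?_
    rw [hh, Matrix.mulVec_sub, Matrix.mulVec_sub]
    simp only [Pi.add_apply, Pi.sub_apply]
    ring
  rw [e1] at h1
  have h2 : ∑ j ∈ T, h j * X.transpose.mulVec z j ≤ √H * W := by
    refine (Real.sum_mul_le_sqrt_mul_sqrt _ _ _).trans ?_
    rw [hHT]
    exact mul_le_mul_of_nonneg_left ((Real.sqrt_le_left hW0).2 hW) (Real.sqrt_nonneg _)
  have h3 : ∑ j, |b j + (β - b) j| - ∑ j, |b j| ≤ √K * √H := by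
    have h4 : ∑ j, |b j + (β - b) j| - ∑ j, |b j| ≤ ∑ j ∈ T, 1 * |h j| := by
      rw [Finset.sum_subset (Finset.subset_univ T) fun j _ hj => by simp [hh0 j hj],
        ← Finset.sum_sub_distrib]
      refine Finset.sum_le_sum fun j _ => ?_
      have h5 := abs_sub_abs_le_abs_sub (β j) (b j)
      simp only [Pi.sub_apply, add_sub_cancel, hh, one_mul]
      rwa [abs_sub_comm (β j)] at h5
    refine h4.trans ((Real.sum_mul_le_sqrt_mul_sqrt _ _ _).trans ?_)
    simp only [one_pow, sq_abs, hHT, Finset.sum_const, nsmul_eq_mul, mul_one]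
    exact mul_le_mul_of_nonneg_right (Real.sqrt_le_sqrt hK) (Real.sqrt_nonneg _)
  -- Restricted isometry bounds `‖h‖²` by `2g/n`, so that `g ≤ B‖h‖` closes up to `g ≤ 2B²/n`.
  have h6 : n * H ≤ 2 * g := by
    have := (abs_le.1 (hRIP h hh0)).1
    have e : ∑ i, (∑ j, X i j * h j) ^ 2 = g := rfl
    rw [e] at this
    linarith
  set B := W + n * lam * √K with hB
  have hB0 : 0 ≤ B := by positivity
  have h7 : g ≤ B * √H := by
    have h8 := mul_le_mul_of_nonneg_left h3 hlam.le
    have h9 : 1 / (n : ℝ) * (g - ∑ j ∈ T, h j * X.transpose.mulVec z j) ≤ lam * (√K * √H) :=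
      h1.trans h8
    rw [one_div, inv_mul_le_iff₀ hn'] at h9
    rw [hB]
    nlinarith
  have h10 : g * g ≤ B ^ 2 * H := by
    calc g * g ≤ (B * √H) * (B * √H) := mul_self_le_mul_self hg0 h7
      _ = B ^ 2 * (√H * √H) := by ring
      _ = B ^ 2 * H := by rw [Real.mul_self_sqrt hH0]
  rcases hg0.eq_or_lt with h0 | h0
  · rw [← h0]
    positivity
  · rw [div_mul_eq_mul_div, le_div_iff₀ hn']
    refine le_of_mul_le_mul_right ?_ h0
    nlinarith [mul_le_mul_of_nonneg_left h6 (sq_nonneg B)]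

/-- If the Lasso restricted to the columns in `T` is strictly dual feasible outside `T`, then
every Lasso estimator is supported in `T`. -/
theorem IsLasso.supp_subset_of_strict (hn : 0 < n) {X : Matrix (Fin n) (Fin p) ℝ}
    {y : Fin n → ℝ} {lam : ℝ} (hlam : 0 < lam) {T : Finset (Fin p)} {b b' : Fin p → ℝ}
    (hb : IsLasso (restrictCols X T) y lam b)
    (hstrict : ∀ j ∉ T, |∑ i, X i j * (y i - X.mulVec b i)| < n * lam)
    (hb' : IsLasso X y lam b') : supp b' ⊆ T := by
  have hn' : (0 : ℝ) < n := by exact_mod_cast hn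
  have hb0 := hb.eq_zero_of_restrictCols hn hlam
  intro j hj
  by_contra hjT
  have hj' : b' j ≠ 0 := (Finset.mem_filter.1 hj).2
  set r : Fin n → ℝ := fun i => y i - X.mulVec b i with hr
  have h1 := hb' b
  unfold lassoObjective at h1
  have e1 : ∑ i, (y i - X.mulVec b' i) ^ 2 = ∑ i, (y i - X.mulVec b i) ^ 2 -
      2 * ∑ i, r i * X.mulVec (b' - b) i + ∑ i, X.mulVec (b' - b) i ^ 2 := by
    rw [Finset.mul_sum, ← Finset.sum_sub_distrib, ← Finset.sum_add_distrib]
    refine Finset.sum_congr rfl fun i _ => ?_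
    rw [Matrix.mulVec_sub]
    simp only [Pi.sub_apply, hr]
    ring
  -- The difference `b' - b` is split along `T`: the part on `T` is controlled by optimality of the
  -- restricted problem, the part outside by strict dual feasibility. A nonzero coordinate outside
  -- `T` would make the objective strictly larger at `b'` than at `b`.
  have h2 := hb.inner_residual_le hn hlam.le fun l => if l ∈ T then b' l - b l else 0
  have e2 : (restrictCols X T).mulVec (fun l => if l ∈ T then b' l - b l else 0) =
      X.mulVec fun l => if l ∈ T then b' l - b l else 0 :=
    restrictCols_mulVec_of_support X fun l hl => by simp [hl]
  rw [e2, restrictCols_mulVec_of_support X hb0] at h2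
  have e3 : ∑ i, r i * X.mulVec (b' - b) i =
      ∑ i, r i * X.mulVec (fun l => if l ∈ T then b' l - b l else 0) i +
        ∑ l, (if l ∈ T then 0 else b' l * ∑ i, X i l * r i) := by
    have e4 : ∀ v : Fin p → ℝ, ∑ i, r i * X.mulVec v i = ∑ l, v l * ∑ i, X i l * r i := by
      intro v
      simp_rw [mulVec_eq_sum, Finset.mul_sum]
      rw [Finset.sum_comm]
      exact Finset.sum_congr rfl fun i _ => Finset.sum_congr rfl fun j _ => by ring
    rw [e4, e4, ← Finset.sum_add_distrib]
    refine Finset.sum_congr rfl fun l _ => ?_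
    by_cases hl : l ∈ T <;> simp [hl, hb0]
  have e5 : ∑ l, |b' l| =
      ∑ l, |b l + if l ∈ T then b' l - b l else 0| + ∑ l, (if l ∈ T then 0 else |b' l|) := by
    rw [← Finset.sum_add_distrib]
    refine Finset.sum_congr rfl fun l _ => ?_
    by_cases hl : l ∈ T <;> simp [hl, hb0]
  have h3 : ∑ l, (if l ∈ T then 0 else b' l * ∑ i, X i l * r i) <
      ∑ l, n * lam * (if l ∈ T then 0 else |b' l|) := by
    refine Finset.sum_lt_sum (fun l _ => ?_) ⟨j, Finset.mem_univ j, ?_⟩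
    · split_ifs with hl
      · simp
      · refine (le_abs_self _).trans ?_
        rw [abs_mul, mul_comm]
        exact mul_le_mul_of_nonneg_right (hstrict l hl).le (abs_nonneg _)
    · rw [if_neg hjT, if_neg hjT]
      refine (le_abs_self _).trans_lt ?_
      rw [abs_mul, mul_comm]
      exact mul_lt_mul_of_pos_right (hstrict j hjT) (abs_pos.2 hj')
  rw [← Finset.mul_sum] at h3
  rw [e1, e3, e5] at h1
  have hD : 0 ≤ ∑ i, X.mulVec (b' - b) i ^ 2 := Finset.sum_nonneg fun i _ => sq_nonneg _
  set D := ∑ i, X.mulVec (b' - b) i ^ 2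
  set Q := ∑ i, (y i - X.mulVec b i) ^ 2
  set R := ∑ i, r i * X.mulVec (fun l => if l ∈ T then b' l - b l else 0) i
  set O := ∑ l, (if l ∈ T then 0 else b' l * ∑ i, X i l * r i)
  set A := ∑ l, |b l + if l ∈ T then b' l - b l else 0|
  set F := ∑ l, (if l ∈ T then 0 else |b' l|)
  have h4 : 1 / (n : ℝ) * R ≤ lam * (A - ∑ j, |b j|) := h2
  have h5 : 1 / (n : ℝ) * O < lam * F := by
    rw [one_div, inv_mul_lt_iff₀ hn']
    linarith
  have e6 : 1 / (2 * (n : ℝ)) * (Q - 2 * (R + O) + D) =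
      1 / (2 * (n : ℝ)) * Q - 1 / (n : ℝ) * R - 1 / (n : ℝ) * O + 1 / (2 * (n : ℝ)) * D := by
    field_simp
    ring
  rw [e6] at h1
  have h6 : 0 ≤ 1 / (2 * (n : ℝ)) * D := by positivity
  linarith

end Deterministic

/-! ### Measurability of events that quantify over Lasso minimizers -/

section Measurability

/-- A closed set in a σ-compact space is a countable union of compact sets, and these have compact,
hence closed, projections. -/
theorem measurableSet_exists_of_isClosed {α γ : Type*} [TopologicalSpace α] [TopologicalSpace γ]
    [SigmaCompactSpace α] [SigmaCompactSpace γ] [T2Space α] [MeasurableSpace α] [BorelSpace α]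
    {C : Set (α × γ)} (hC : IsClosed C) : MeasurableSet {x | ∃ b, (x, b) ∈ C} := by
  have h1 : IsSigmaCompact C :=
    (isSigmaCompact_univ (X := α × γ)).of_isClosed_subset hC (Set.subset_univ _)
  have h2 := h1.image (f := Prod.fst) continuous_fst
  have h3 : {x | ∃ b, (x, b) ∈ C} = Prod.fst '' C := by
    ext x
    simp
  rw [h3]
  obtain ⟨K, hK, hK'⟩ := h2
  rw [← hK']
  exact MeasurableSet.iUnion fun i => (hK i).isClosed.measurableSet

variable {n p : ℕ}

theorem isClosed_isLasso {α : Type*} [TopologicalSpace α] {X : α → Matrix (Fin n) (Fin p) ℝ}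
    {y : α → Fin n → ℝ} {b : α → Fin p → ℝ} (lam : ℝ) (hX : Continuous X) (hy : Continuous y)
    (hb : Continuous b) : IsClosed {x | IsLasso (X x) (y x) lam (b x)} := by
  have : {x | IsLasso (X x) (y x) lam (b x)} = ⋂ b' : Fin p → ℝ,
      {x | lassoObjective (X x) (y x) lam (b x) ≤ lassoObjective (X x) (y x) lam b'} := by
    ext x
    simp [IsLasso]
  rw [this]
  refine isClosed_iInter fun b' => isClosed_le ?_ ?_ <;>
  · unfold lassoObjective
    simp only [mulVec_eq_sum]
    fun_prop

/-- The union of `S` and of the indices `j` with `|X_jᵀ z| > a ‖z‖`. -/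
noncomputable def screenedSet (X : Matrix (Fin n) (Fin p) ℝ) (z : Fin n → ℝ) (S : Finset (Fin p))
    (a : ℝ) : Finset (Fin p) :=
  S ∪ Finset.univ.filter fun j => a * √(∑ i, z i ^ 2) < |X.transpose.mulVec z j|

theorem mem_screenedSet {X : Matrix (Fin n) (Fin p) ℝ} {z : Fin n → ℝ} {S : Finset (Fin p)}
    {a : ℝ} {j : Fin p} : j ∈ screenedSet X z S a ↔
      j ∈ S ∨ a * √(∑ i, z i ^ 2) < |X.transpose.mulVec z j| := by
  simp [screenedSet]

theorem measurableSet_mem_screenedSet {α : Type*} [MeasurableSpace α]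
    {X : α → Fin n → Fin p → ℝ} {z : α → Fin n → ℝ} (hX : Measurable X) (hz : Measurable z)
    (S : Finset (Fin p)) (a : ℝ) (j : Fin p) :
    MeasurableSet {x | j ∈ screenedSet (Matrix.of (X x)) (z x) S a} := by
  simp only [mem_screenedSet, transpose_mulVec_eq_sum, Matrix.of_apply]
  have h : MeasurableSet {x | a * √(∑ i, z x i ^ 2) < |∑ i, X x i j * z x i|} := by
    refine measurableSet_lt ?_ ?_ <;> fun_prop
  exact (MeasurableSet.const (j ∈ S)).union h

/-- The event that the index `j` is not screened and that the column `X_j` has a large inner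
product with the error of the fit of a Lasso on the screened columns. -/
def leakEvent (z : Fin n → ℝ) (β : Fin p → ℝ) (S : Finset (Fin p)) (a lam ρ c : ℝ) (j : Fin p) :
    Set (Fin n → Fin p → ℝ) :=
  {X | j ∉ screenedSet (Matrix.of X) z S a ∧
    ∃ b, IsLasso (restrictCols (Matrix.of X) (screenedSet (Matrix.of X) z S a))
        ((Matrix.of X).mulVec β + z) lam b ∧
      ∑ i, (Matrix.of X).mulVec (b - β) i ^ 2 ≤ ρ ^ 2 ∧
      c ≤ |∑ i, X i j * (Matrix.of X).mulVec (b - β) i|}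

/-- The screened set takes finitely many values `T`. For each of them the conditions on `(X, b)` are
closed. -/
theorem measurableSet_leakEvent (z : Fin n → ℝ) (β : Fin p → ℝ) (S : Finset (Fin p))
    (a lam ρ c : ℝ) (j : Fin p) : MeasurableSet (leakEvent z β S a lam ρ c j) := by
  have h1 : leakEvent z β S a lam ρ c j = ⋃ T : Finset (Fin p),
      ({X | j ∉ screenedSet (Matrix.of X) z S a} ∩
        {X | ∀ l, l ∈ screenedSet (Matrix.of X) z S a ↔ l ∈ T}) ∩
      {X : Fin n → Fin p → ℝ | ∃ b, (X, b) ∈ {q : (Fin n → Fin p → ℝ) × (Fin p → ℝ) |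
        IsLasso (restrictCols (Matrix.of q.1) T) ((Matrix.of q.1).mulVec β + z) lam q.2 ∧
        ∑ i, (Matrix.of q.1).mulVec (q.2 - β) i ^ 2 ≤ ρ ^ 2 ∧
        c ≤ |∑ i, q.1 i j * (Matrix.of q.1).mulVec (q.2 - β) i|}} := by
    ext X
    simp only [leakEvent, Set.mem_iUnion, Set.mem_inter_iff, Set.mem_ofPred_eq]
    constructor
    · rintro ⟨h1, h2⟩
      exact ⟨_, ⟨h1, fun l => Iff.rfl⟩, h2⟩
    · rintro ⟨T, ⟨h1, hT⟩, h2⟩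
      obtain rfl : screenedSet (Matrix.of X) z S a = T := Finset.ext hT
      exact ⟨h1, h2⟩
  rw [h1]
  refine MeasurableSet.iUnion fun T => MeasurableSet.inter (MeasurableSet.inter ?_ ?_) ?_
  · exact (measurableSet_mem_screenedSet measurable_id measurable_const S a j).compl
  · rw [show {X : Fin n → Fin p → ℝ | ∀ l, l ∈ screenedSet (Matrix.of X) z S a ↔ l ∈ T} =
      ⋂ l, {X | l ∈ screenedSet (Matrix.of X) z S a ↔ l ∈ T} by ext; simp]
    refine MeasurableSet.iInter fun l => ?_
    exact (measurableSet_mem_screenedSet measurable_id measurable_const S a l).iff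
      (MeasurableSet.const _)
  · refine measurableSet_exists_of_isClosed (IsClosed.inter ?_ (IsClosed.inter ?_ ?_))
    · refine isClosed_isLasso lam ?_ ?_ continuous_snd
      · refine continuous_matrix fun i l => ?_
        simp only [restrictCols, Matrix.of_apply]
        split_ifs <;> fun_prop
      · refine continuous_pi fun i => ?_
        simp only [Pi.add_apply, mulVec_eq_sum, Matrix.of_apply]
        fun_prop
    · have h : IsClosed {q : (Fin n → Fin p → ℝ) × (Fin p → ℝ) |
          ∑ i, (∑ l, q.1 i l * (q.2 l - β l)) ^ 2 ≤ ρ ^ 2} := by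
        refine isClosed_le ?_ ?_ <;> fun_prop
      exact h
    · have h : IsClosed {q : (Fin n → Fin p → ℝ) × (Fin p → ℝ) |
          c ≤ |∑ i, q.1 i j * ∑ l, q.1 i l * (q.2 l - β l)|} := by
        refine isClosed_le ?_ ?_ <;> fun_prop
      exact h

end Measurability

/-! ### Decoupling an unscreened column from the restricted fit -/

section Leak

variable {n p : ℕ}

theorem sum_resampleColumn_mul (u : Fin n → ℝ) (hu : ∑ i, u i ^ 2 = 1) (j : Fin p)
    (X : Fin n → Fin p → ℝ) (y : Fin n → ℝ) (l : Fin p) :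
    ∑ i, resampleColumn u j X y i l * u i = ∑ i, X i l * u i := by
  by_cases hl : l = j
  · subst hl
    simp only [resampleColumn, if_true]
    have : ∀ i, (u i * ∑ a, u a * X a l + (y i - u i * ∑ a, u a * y a)) * u i =
        u i ^ 2 * (∑ a, u a * X a l) + u i * y i - u i ^ 2 * ∑ a, u a * y a := fun i => by ring
    simp_rw [this]
    rw [Finset.sum_sub_distrib, Finset.sum_add_distrib, ← Finset.sum_mul, ← Finset.sum_mul, hu]
    simp only [one_mul, add_sub_cancel_right]
    exact Finset.sum_congr rfl fun i _ => mul_comm _ _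
  · exact Finset.sum_congr rfl fun i _ => by simp [resampleColumn, hl]

/-- Conditional estimate given `X`. Resampling preserves `Xᵀu`, hence the screened set `T`. For `j ∉
T` it also preserves the restricted design and, as `β` vanishes at `j`, the response. The fit error
`v` is then fixed, and only the linear form of `y` with the component of `v` orthogonal to `u` is
random. -/
theorem gaussVec_resample_mem_leakEvent_le (hn : 0 < n) {z u : Fin n → ℝ} {r : ℝ} (hr : 0 < r)
    (hu : ∑ i, u i ^ 2 = 1) (hz : ∀ i, z i = r * u i) {β : Fin p → ℝ} {S : Finset (Fin p)}
    (hβ : ∀ l ∉ S, β l = 0) {a lam ρ c : ℝ} (ha : 0 ≤ a) (hlam : 0 < lam) (hρ : 0 < ρ)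
    (hc : a * ρ ≤ c) (j : Fin p) (X : Fin n → Fin p → ℝ) :
    gaussVec (Fin n) {y | resampleColumn u j X y ∈ leakEvent z β S a lam ρ c j} ≤
      ENNReal.ofReal (2 * Real.exp (-((c - a * ρ) ^ 2 / (2 * ρ ^ 2)))) := by
  have hzn : √(∑ i, z i ^ 2) = r := by
    simp_rw [hz, mul_pow]
    rw [← Finset.mul_sum, hu, mul_one, Real.sqrt_sq hr.le]
  have htr : ∀ (X : Fin n → Fin p → ℝ) l,
      (Matrix.of X).transpose.mulVec z l = r * ∑ i, X i l * u i := by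
    intro X l
    rw [transpose_mulVec_eq_sum, Finset.mul_sum]
    refine Finset.sum_congr rfl fun i _ => ?_
    rw [hz, Matrix.of_apply]
    ring
  have hscr : ∀ y, screenedSet (Matrix.of (resampleColumn u j X y)) z S a =
      screenedSet (Matrix.of X) z S a := by
    intro y
    ext l
    rw [mem_screenedSet, mem_screenedSet, htr, htr, sum_resampleColumn_mul u hu]
  set T := screenedSet (Matrix.of X) z S a with hT
  by_cases hjT : j ∈ T
  · have : {y | resampleColumn u j X y ∈ leakEvent z β S a lam ρ c j} = ∅ := by
      ext y
      simp only [leakEvent, Set.mem_ofPred_eq, hscr, Set.mem_empty_iff_false, iff_false]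
      exact fun h => h.1 hjT
    rw [this, measure_empty]
    exact zero_le
  have hw : |∑ i, X i j * u i| ≤ a := by
    have h1 : ¬ (j ∈ S ∨ _) := fun h => hjT (mem_screenedSet.2 h)
    have h2 := not_lt.1 fun h => h1 (Or.inr h)
    rw [htr, hzn, abs_mul, abs_of_pos hr, mul_comm a] at h2
    exact le_of_mul_le_mul_left h2 hr
  have hjS : j ∉ S := fun h => hjT (mem_screenedSet.2 (Or.inl h))
  have hres : ∀ y, restrictCols (Matrix.of (resampleColumn u j X y)) T =
      restrictCols (Matrix.of X) T := by
    intro y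
    ext i l
    simp only [restrictCols, Matrix.of_apply]
    split_ifs with hl
    · have : l ≠ j := fun h => hjT (h ▸ hl)
      simp [resampleColumn, this]
    · rfl
  have hmul : ∀ y (v : Fin p → ℝ), v j = 0 →
      (Matrix.of (resampleColumn u j X y)).mulVec v = (Matrix.of X).mulVec v := by
    intro y v hv
    funext i
    simp only [mulVec_eq_sum, Matrix.of_apply]
    refine Finset.sum_congr rfl fun l _ => ?_
    by_cases hl : l = j
    · subst hl
      simp [hv]
    · simp [resampleColumn, hl]
  have hev : ∀ y, resampleColumn u j X y ∈ leakEvent z β S a lam ρ c j → ∃ b,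
      IsLasso (restrictCols (Matrix.of X) T) ((Matrix.of X).mulVec β + z) lam b ∧
      ∑ i, (Matrix.of X).mulVec (b - β) i ^ 2 ≤ ρ ^ 2 ∧
      c ≤ |∑ i, resampleColumn u j X y i j * (Matrix.of X).mulVec (b - β) i| := by
    rintro y ⟨-, b, hb, hb1, hb2⟩
    rw [hscr, hres, hmul y β (hβ j hjS)] at hb
    have hbj := hb.eq_zero_of_restrictCols hn hlam j hjT
    rw [hmul y (b - β) (by simp [hbj, hβ j hjS])] at hb1 hb2
    exact ⟨b, hb, hb1, hb2⟩
  rcases Set.eq_empty_or_nonempty {y | resampleColumn u j X y ∈ leakEvent z β S a lam ρ c j}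
    with h0 | ⟨y0, hy0⟩
  · rw [h0, measure_empty]
    exact zero_le
  obtain ⟨b0, hb0, hv, -⟩ := hev y0 hy0
  set v := (Matrix.of X).mulVec (b0 - β) with hvdef
  set s := ∑ i, u i * v i with hs
  have hproj : ∑ i, (v i - u i * s) ^ 2 = ∑ i, v i ^ 2 - s ^ 2 := by
    have : ∀ i, (v i - u i * s) ^ 2 = v i ^ 2 - 2 * s * (u i * v i) + s ^ 2 * u i ^ 2 :=
      fun i => by ring
    simp_rw [this]
    rw [Finset.sum_add_distrib, Finset.sum_sub_distrib, ← Finset.mul_sum, ← Finset.mul_sum, hu,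
      ← hs]
    ring
  have hs2 : |s| ≤ ρ := by
    refine abs_le_of_sq_le_sq ?_ hρ.le
    have : 0 ≤ ∑ i, (v i - u i * s) ^ 2 := Finset.sum_nonneg fun i _ => sq_nonneg _
    linarith
  refine le_trans (measure_mono fun y hy => ?_) (gaussVec_abs_linear_ge_le
    (v := fun i => v i - u i * s) hρ (sub_nonneg.2 hc)
    (by rw [hproj]; linarith [sq_nonneg s]))
  obtain ⟨b, hb, -, hb2⟩ := hev y hy
  -- The minimizer may vary with `y`, but fitted values are unique, so the error vector is the same
  -- for all `y`.
  have hfit : (Matrix.of X).mulVec (b - β) = v := by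
    have h1 := hb.mulVec_eq hn hlam.le hb0
    rw [restrictCols_mulVec_of_support _ (hb.eq_zero_of_restrictCols hn hlam),
      restrictCols_mulVec_of_support _ (hb0.eq_zero_of_restrictCols hn hlam)] at h1
    rw [hvdef, Matrix.mulVec_sub, Matrix.mulVec_sub, h1]
  rw [hfit] at hb2
  have e1 : ∑ i, resampleColumn u j X y i j * v i =
      (∑ i, X i j * u i) * s + ∑ i, (v i - u i * s) * y i := by
    simp only [resampleColumn, if_true]
    have h1 : ∀ i, (u i * ∑ a, u a * X a j + (y i - u i * ∑ a, u a * y a)) * v i =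
        (∑ a, u a * X a j) * (u i * v i) + (v i * y i - (∑ a, u a * y a) * (u i * v i)) :=
      fun i => by ring
    have h2 : ∀ i, (v i - u i * s) * y i = v i * y i - s * (u i * y i) := fun i => by ring
    simp_rw [h1, h2]
    rw [Finset.sum_add_distrib, Finset.sum_sub_distrib, Finset.sum_sub_distrib, ← Finset.mul_sum,
      ← Finset.mul_sum, ← Finset.mul_sum, ← hs]
    have h3 : ∑ a, u a * X a j = ∑ i, X i j * u i := Finset.sum_congr rfl fun i _ => mul_comm _ _
    rw [h3]
    ring
  rw [e1] at hb2
  have h4 := abs_add_le ((∑ i, X i j * u i) * s) (∑ i, (v i - u i * s) * y i)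
  have h5 : |(∑ i, X i j * u i) * s| ≤ a * ρ := by
    rw [abs_mul]
    exact mul_le_mul hw hs2 (abs_nonneg _) ha
  show c - a * ρ ≤ |∑ i, (v i - u i * s) * y i|
  linarith

/-- Resampling preserves the law of `X`, so the probability is the average over `X` of the
conditional one. -/
theorem gaussMat_leakEvent_le (hn : 0 < n) {z u : Fin n → ℝ} {r : ℝ} (hr : 0 < r)
    (hu : ∑ i, u i ^ 2 = 1) (hz : ∀ i, z i = r * u i) {β : Fin p → ℝ} {S : Finset (Fin p)}
    (hβ : ∀ l ∉ S, β l = 0) {a lam ρ c : ℝ} (ha : 0 ≤ a) (hlam : 0 < lam) (hρ : 0 < ρ)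
    (hc : a * ρ ≤ c) (j : Fin p) :
    gaussMat (Fin n) (Fin p) (leakEvent z β S a lam ρ c j) ≤
      ENNReal.ofReal (2 * Real.exp (-((c - a * ρ) ^ 2 / (2 * ρ ^ 2)))) := by
  have hmeas := measurableSet_leakEvent z β S a lam ρ c j
  have hf : Measurable fun q : (Fin n → Fin p → ℝ) × (Fin n → ℝ) =>
      resampleColumn u j q.1 q.2 := by
    refine measurable_pi_lambda _ fun i => measurable_pi_lambda _ fun l => ?_
    unfold resampleColumn
    split_ifs <;> fun_prop
  rw [← map_resampleColumn u hu j, Measure.map_apply hf hmeas, Measure.prod_apply (hf hmeas)]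
  calc _ ≤ ∫⁻ _, ENNReal.ofReal (2 * Real.exp (-((c - a * ρ) ^ 2 / (2 * ρ ^ 2))))
        ∂gaussMat (Fin n) (Fin p) := lintegral_mono fun X =>
          gaussVec_resample_mem_leakEvent_le hn hr hu hz hβ ha hlam hρ hc j X
    _ = _ := by rw [lintegral_const, measure_univ, mul_one]

end Leak

/-! ### Size of the screened set and localization of the Lasso -/

section Screening

variable {n p : ℕ}

/-- The energy of the large coordinates of a standard Gaussian vector is small. -/
theorem gaussVec_energy_gt_le {S : Finset (Fin p)} {k : ℕ} (hS : S.card ≤ k) (hk : 0 < k)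
    {a s s' M : ℝ} (hs : 0 ≤ s) (hss' : s < s') (hs' : s' < 1 / 2) (ha : 0 ≤ a) (hM : 0 < M)
    (hpk : p * Real.exp (-(s * a ^ 2)) ≤ k) :
    gaussVec (Fin p) {w | k * M < ∑ l, if l ∈ S ∨ a < |w l| then w l ^ 2 else 0} ≤
      ENNReal.ofReal (2 * ((s' - s)⁻¹ * (√(1 - 2 * s'))⁻¹) / M) := by
  set D := (s' - s)⁻¹ with hD
  have hss : 0 < s' - s := sub_pos.2 hss'
  have hD0 : 0 < D := inv_pos.2 hss
  set I := (√(1 - 2 * s'))⁻¹ with hI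
  have hI0 : 0 < I := by
    have : 0 < 1 - 2 * s' := by linarith
    positivity
  have hk' : (0 : ℝ) < k := by exact_mod_cast hk
  -- An integrable majorant of the energy: `w² ≤ D exp((s' - s)w²)` always, and on `|w| > a` a
  -- factor `exp(-sa²)` is gained by raising the exponent to `s'w²`. The expectation is thus at most
  -- `(k + p exp(-sa²)) D I ≤ 2k D I`, and Markov applies.
  let f : Fin p → (Fin p → ℝ) → ℝ := fun l w =>
    ((if l ∈ S then D else 0) + D * Real.exp (-(s * a ^ 2))) * Real.exp (s' * w l ^ 2)
  have hfint : ∀ l, Integrable (f l) (gaussVec (Fin p)) := fun l =>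
    (integrable_comp_eval (μ := fun _ : Fin p => gaussianReal 0 1) (i := l)
      (integrable_exp_sq_gaussianReal hs')).const_mul _
  have hfI : ∀ l, ∫ w, f l w ∂gaussVec (Fin p) =
      ((if l ∈ S then D else 0) + D * Real.exp (-(s * a ^ 2))) * I := by
    intro l
    simp only [f]
    rw [integral_const_mul]
    congr 1
    have := integral_comp_eval (μ := fun _ : Fin p => gaussianReal 0 1) (i := l)
      (f := fun x : ℝ => Real.exp (s' * x ^ 2)) (by fun_prop)
    rw [this, integral_exp_sq_gaussianReal hs']
  have hsq : ∀ x : ℝ, x ^ 2 ≤ D * Real.exp ((s' - s) * x ^ 2) := by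
    intro x
    have h1 := Real.add_one_le_exp ((s' - s) * x ^ 2)
    rw [hD, ← div_eq_inv_mul, le_div_iff₀ hss]
    linarith
  have hle : ∀ w : Fin p → ℝ,
      (∑ l, if l ∈ S ∨ a < |w l| then w l ^ 2 else 0) ≤ ∑ l, f l w := by
    intro w
    refine Finset.sum_le_sum fun l _ => ?_
    have h1 := hsq (w l)
    have hB : 0 ≤ D * Real.exp (-(s * a ^ 2)) * Real.exp (s' * w l ^ 2) := by positivity
    simp only [f]
    by_cases hl : l ∈ S
    · rw [if_pos (Or.inl hl), if_pos hl, add_mul]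
      have h2 : Real.exp ((s' - s) * w l ^ 2) ≤ Real.exp (s' * w l ^ 2) :=
        Real.exp_le_exp.2 (mul_le_mul_of_nonneg_right (by linarith) (sq_nonneg _))
      have h3 := mul_le_mul_of_nonneg_left h2 hD0.le
      linarith
    · rw [if_neg hl, zero_add]
      split_ifs with h2
      · have h3 : a < |w l| := h2.resolve_left hl
        have h4 : a ^ 2 ≤ w l ^ 2 := by
          rw [← sq_abs (w l)]
          exact pow_le_pow_left₀ ha h3.le 2
        refine h1.trans ?_
        rw [mul_assoc, ← Real.exp_add]
        refine mul_le_mul_of_nonneg_left (Real.exp_le_exp.2 ?_) hD0.le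
        nlinarith [mul_le_mul_of_nonneg_left h4 hs]
      · exact hB
  have hsumI : ∫ w, ∑ l, f l w ∂gaussVec (Fin p) ≤ k * (2 * (D * I)) := by
    rw [integral_finsetSum _ fun l _ => hfint l]
    simp_rw [hfI]
    rw [← Finset.sum_mul, Finset.sum_add_distrib, Finset.sum_ite_mem, Finset.univ_inter,
      Finset.sum_const, Finset.sum_const, nsmul_eq_mul, nsmul_eq_mul, Finset.card_univ,
      Fintype.card_fin]
    have h1 : (S.card : ℝ) ≤ k := by exact_mod_cast hS
    have h2 : (S.card : ℝ) * D + p * (D * Real.exp (-(s * a ^ 2))) ≤ k * D + k * D := by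
      have := mul_le_mul_of_nonneg_right h1 hD0.le
      have := mul_le_mul_of_nonneg_right hpk hD0.le
      nlinarith
    have h3 := mul_le_mul_of_nonneg_right h2 hI0.le
    linarith
  have hmark := mul_meas_ge_le_integral_of_nonneg (μ := gaussVec (Fin p))
    (f := fun w => ∑ l, f l w) (.of_forall fun w => Finset.sum_nonneg fun l _ => by
      simp only [f]
      split_ifs <;> positivity) (integrable_finsetSum _ fun l _ => hfint l) (k * M)
  have hreal : (gaussVec (Fin p)).real
      {w | k * M < ∑ l, if l ∈ S ∨ a < |w l| then w l ^ 2 else 0} ≤ 2 * (D * I) / M := by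
    have h1 : (gaussVec (Fin p)).real
        {w | k * M < ∑ l, if l ∈ S ∨ a < |w l| then w l ^ 2 else 0} ≤
        (gaussVec (Fin p)).real {w | k * M ≤ ∑ l, f l w} :=
      measureReal_mono fun w hw => (le_of_lt hw).trans (hle w)
    refine h1.trans ?_
    rw [le_div_iff₀ hM]
    have h2 := hmark.trans hsumI
    refine le_of_mul_le_mul_left ?_ hk'
    linarith
  rw [← ENNReal.ofReal_toReal (measure_ne_top (gaussVec (Fin p)) _)]
  exact ENNReal.ofReal_le_ofReal hreal

/-- The event that some Lasso estimator is not supported in the screened set, or that more than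
`k` indices outside `S` are screened. -/
def screeningFailure (n p k : ℕ) (β : Fin p → ℝ) (S : Finset (Fin p)) (a lam : ℝ) :
    Set ((Fin n → Fin p → ℝ) × (Fin n → ℝ)) :=
  {ω | (∃ b, IsLasso (Matrix.of ω.1) (response (Matrix.of ω.1) β ω.2) lam b ∧
      ¬ supp b ⊆ screenedSet (Matrix.of ω.1) ω.2 S a) ∨
    k < (screenedSet (Matrix.of ω.1) ω.2 S a \ S).card}

/-- The condition `b l ≠ 0` is not closed, so it is written as a countable union of the closed
conditions `|b l| ≥ 1/(N + 1)`. -/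
theorem measurableSet_screeningFailure (n p k : ℕ) (β : Fin p → ℝ) (S : Finset (Fin p))
    (a lam : ℝ) : MeasurableSet (screeningFailure n p k β S a lam) := by
  have hscr := fun l => measurableSet_mem_screenedSet
    (α := (Fin n → Fin p → ℝ) × (Fin n → ℝ)) measurable_fst measurable_snd S a l
  have h1 : screeningFailure n p k β S a lam =
      (⋃ l, {ω | l ∈ screenedSet (Matrix.of ω.1) ω.2 S a}ᶜ ∩ ⋃ N : ℕ,
        {ω : (Fin n → Fin p → ℝ) × (Fin n → ℝ) | ∃ b, (ω, b) ∈
          {q : ((Fin n → Fin p → ℝ) × (Fin n → ℝ)) × (Fin p → ℝ) |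
            IsLasso (Matrix.of q.1.1) (response (Matrix.of q.1.1) β q.1.2) lam q.2 ∧
            1 / ((N : ℝ) + 1) ≤ |q.2 l|}}) ∪
      ⋃ T : Finset (Fin p), ⋃ (_ : k < (T \ S).card), ⋂ l,
        {ω | l ∈ screenedSet (Matrix.of ω.1) ω.2 S a ↔ l ∈ T} := by
    ext ω
    simp only [screeningFailure, Set.mem_union, Set.mem_iUnion, Set.mem_inter_iff,
      Set.mem_compl_iff, Set.mem_ofPred_eq, Set.mem_iInter]
    refine or_congr ⟨?_, ?_⟩ ⟨?_, ?_⟩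
    · rintro ⟨b, hb, hsub⟩
      obtain ⟨l, hl, hlT⟩ := Finset.not_subset.1 hsub
      have hbl : b l ≠ 0 := (Finset.mem_filter.1 hl).2
      obtain ⟨N, hN⟩ := exists_nat_one_div_lt (abs_pos.2 hbl)
      exact ⟨l, hlT, N, b, hb, hN.le⟩
    · rintro ⟨l, hlT, N, b, hb, hN⟩
      refine ⟨b, hb, fun hsub => hlT (hsub (Finset.mem_filter.2 ⟨Finset.mem_univ l, ?_⟩))⟩
      have : 0 < 1 / ((N : ℝ) + 1) := by positivity
      exact abs_pos.1 (this.trans_le hN)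
    · intro h
      exact ⟨_, h, fun l => Iff.rfl⟩
    · rintro ⟨T, hT, h⟩
      rwa [Finset.ext h]
  rw [h1]
  refine MeasurableSet.union (MeasurableSet.iUnion fun l => ?_)
    (MeasurableSet.iUnion fun T => MeasurableSet.iUnion fun _ => MeasurableSet.iInter fun l =>
      (hscr l).iff (MeasurableSet.const _))
  refine (hscr l).compl.inter (MeasurableSet.iUnion fun N => ?_)
  refine measurableSet_exists_of_isClosed (IsClosed.inter ?_ ?_)
  · refine isClosed_isLasso lam ?_ ?_ continuous_snd
    · exact continuous_matrix fun i l => by simp only [Matrix.of_apply]; fun_prop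
    · refine continuous_pi fun i => ?_
      simp only [response, Pi.add_apply, mulVec_eq_sum, Matrix.of_apply]
      fun_prop
  · have h : IsClosed {q : ((Fin n → Fin p → ℝ) × (Fin n → ℝ)) × (Fin p → ℝ) |
        1 / ((N : ℝ) + 1) ≤ |q.2 l|} := by
      refine isClosed_le ?_ ?_ <;> fun_prop
    exact h

/-- For a fixed noise vector the screening fails with small probability. -/
theorem gaussMat_screeningFailure_le (hn : 0 < n) {z : Fin n → ℝ} {R : ℝ}
    (hz0 : 0 < ∑ i, z i ^ 2) (hzR : √(∑ i, z i ^ 2) ≤ R) {β : Fin p → ℝ} {S : Finset (Fin p)}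
    (hβ : ∀ l ∉ S, β l = 0) {k m : ℕ} (hS : S.card ≤ k) (hk : 0 < k) (hkm : 2 * k ≤ m)
    (hmp : m ≤ p) {a s s' M lam ρ c : ℝ} (hs : 0 ≤ s) (hss' : s < s') (hs' : s' < 1 / 2)
    (ha : 0 < a) (hM : 0 < M) (hMa : M ≤ a ^ 2) (hpk : p * Real.exp (-(s * a ^ 2)) ≤ k)
    (hlam : 0 < lam) (hρ : 0 < ρ)
    (hfit : 2 / n * (R * √(k * M) + n * lam * √m) ^ 2 ≤ ρ ^ 2)
    (hc : a * ρ ≤ c) (hdual : a * R + c ≤ n * lam) :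
    gaussMat (Fin n) (Fin p) {X | (X, z) ∈ screeningFailure n p k β S a lam} ≤
      gaussMat (Fin n) (Fin p)
        {X | ¬ ∀ A : Finset (Fin p), A.card = m → RestrictedIsometry X A (1 / 2)} +
      ENNReal.ofReal (2 * ((s' - s)⁻¹ * (√(1 - 2 * s'))⁻¹) / M) +
      p * ENNReal.ofReal (2 * Real.exp (-((c - a * ρ) ^ 2 / (2 * ρ ^ 2)))) := by
  set r := √(∑ i, z i ^ 2) with hr
  have hr0 : 0 < r := Real.sqrt_pos.2 hz0
  set u : Fin n → ℝ := fun i => r⁻¹ * z i with hu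
  have hzu : ∀ i, z i = r * u i := fun i => by
    rw [hu]
    field_simp
  have hu1 : ∑ i, u i ^ 2 = 1 := by
    simp only [hu, mul_pow]
    rw [← Finset.mul_sum, inv_pow, hr, Real.sq_sqrt hz0.le, inv_mul_cancel₀ hz0.ne']
  have htr : ∀ (X : Fin n → Fin p → ℝ) l,
      (Matrix.of X).transpose.mulVec z l = r * ∑ i, X i l * u i := by
    intro X l
    rw [transpose_mulVec_eq_sum, Finset.mul_sum]
    refine Finset.sum_congr rfl fun i _ => ?_
    rw [hzu, Matrix.of_apply]
    ring
  have hmem : ∀ (X : Fin n → Fin p → ℝ) l, l ∈ screenedSet (Matrix.of X) z S a ↔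
      l ∈ S ∨ a < |∑ i, X i l * u i| := by
    intro X l
    rw [mem_screenedSet, htr, ← hr, abs_mul, abs_of_pos hr0, mul_comm a, mul_lt_mul_iff_right₀ hr0]
  let F : Set (Fin n → Fin p → ℝ) := {X | k * M <
    ∑ l, if l ∈ S ∨ a < |∑ i, X i l * u i| then (∑ i, X i l * u i) ^ 2 else 0}
  have hF : gaussMat (Fin n) (Fin p) F ≤
      ENNReal.ofReal (2 * ((s' - s)⁻¹ * (√(1 - 2 * s'))⁻¹) / M) := by
    have h1 := gaussVec_energy_gt_le hS hk hs hss' hs' ha.le hM hpk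
    rw [← gaussMat_map_transpose_mulVec (ι := Fin n) u hu1, Measure.map_apply (by fun_prop)] at h1
    · exact h1
    · refine measurableSet_lt measurable_const (Finset.measurable_sum _ fun l _ => ?_)
      refine Measurable.ite ?_ (by fun_prop) measurable_const
      have h2 : MeasurableSet {w : Fin p → ℝ | a < |w l|} := by
        refine measurableSet_lt ?_ ?_ <;> fun_prop
      exact (MeasurableSet.const (l ∈ S)).union h2
  have hsub : {X | (X, z) ∈ screeningFailure n p k β S a lam} ⊆
      ({X | ¬ ∀ A : Finset (Fin p), A.card = m → RestrictedIsometry X A (1 / 2)} ∪ F) ∪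
        ⋃ j ∈ (Finset.univ : Finset (Fin p)), leakEvent z β S a lam ρ c j := by
    intro X hX
    by_contra hgood
    simp only [Set.mem_union, Set.mem_iUnion, not_or, not_exists, Set.mem_ofPred_eq, not_not]
      at hgood
    obtain ⟨⟨hRIP, hXF⟩, hleak⟩ := hgood
    set T := screenedSet (Matrix.of X) z S a with hT
    have hXF' : ∑ l ∈ T, (∑ i, X i l * u i) ^ 2 ≤ k * M := by
      have h1 : (∑ l, if l ∈ S ∨ a < |∑ i, X i l * u i| then (∑ i, X i l * u i) ^ 2 else 0) ≤
          k * M := not_lt.1 fun h => hXF h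
      rw [← Finset.sum_filter] at h1
      convert h1 using 2
      ext l
      simp [hT, hmem]
    -- Each index of `T \ S` has energy above `a² ≥ M`, and the total is at most `kM`.
    have hcard : (T \ S).card ≤ k := by
      have h1 : ((T \ S).card : ℝ) * a ^ 2 ≤ ∑ l ∈ T, (∑ i, X i l * u i) ^ 2 := by
        rw [← nsmul_eq_mul, ← Finset.sum_const]
        refine le_trans (Finset.sum_le_sum fun l hl => ?_)
          (Finset.sum_le_sum_of_subset_of_nonneg Finset.sdiff_subset
            fun l _ _ => sq_nonneg _)
        obtain ⟨hl1, hl2⟩ := Finset.mem_sdiff.1 hl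
        have h2 := ((hmem X l).1 hl1).resolve_left hl2
        rw [← sq_abs (∑ i, X i l * u i)]
        exact pow_le_pow_left₀ ha.le h2.le 2
      have h3 : ((T \ S).card : ℝ) * a ^ 2 ≤ k * a ^ 2 :=
        (h1.trans hXF').trans (mul_le_mul_of_nonneg_left hMa (Nat.cast_nonneg _))
      exact_mod_cast le_of_mul_le_mul_right h3 (by positivity)
    have hST : S ⊆ T := Finset.subset_union_left
    have hTm : T.card ≤ m := by
      have := Finset.card_sdiff_add_card_eq_card hST
      omega
    obtain ⟨A, hTA, -, hA⟩ := Finset.exists_subsuperset_card_eq (Finset.subset_univ T) hTm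
      (by rwa [Finset.card_univ, Fintype.card_fin])
    have hRIPT := (hRIP A hA).mono hTA
    rcases hX with ⟨b', hb', hb'T⟩ | hX
    swap
    · exact absurd hX (not_lt.2 hcard)
    refine hb'T ?_
    obtain ⟨b, hb⟩ := exists_isLasso (restrictCols (Matrix.of X) T)
      ((Matrix.of X).mulVec β + z) hlam
    have hpred := hb.prediction_error_le hn hlam (fun l hl => hβ l fun h => hl (hST h))
      (W := R * √(k * M)) (K := m) (mul_nonneg (hr0.le.trans hzR) (Real.sqrt_nonneg _)) ?_
      (by exact_mod_cast hTm) hRIPT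
    swap
    · simp_rw [htr, mul_pow]
      rw [← Finset.mul_sum, Real.sq_sqrt (show 0 ≤ k * M by positivity)]
      exact mul_le_mul (pow_le_pow_left₀ hr0.le hzR 2) hXF'
        (Finset.sum_nonneg fun l _ => sq_nonneg _) (sq_nonneg _)
    refine hb.supp_subset_of_strict hn hlam (fun j hj => ?_) hb'
    have h1 : |∑ i, X i j * (Matrix.of X).mulVec (b - β) i| < c := by
      by_contra! h
      exact hleak j (Finset.mem_univ j) ⟨hj, b, hb, hpred.trans hfit, h⟩
    have h2 : |(Matrix.of X).transpose.mulVec z j| ≤ a * R := by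
      have h3 : ¬ (j ∈ S ∨ a < |∑ i, X i j * u i|) := fun h => hj ((hmem X j).2 h)
      have h4 := not_lt.1 fun h => h3 (Or.inr h)
      rw [htr, abs_mul, abs_of_pos hr0, mul_comm]
      exact mul_le_mul h4 hzR hr0.le ha.le
    -- The dual variable at `j` is a noise term of size at most `aR` minus a leakage term below `c`,
    -- and `aR + c ≤ nλ`.
    have e : ∑ i, Matrix.of X i j * (((Matrix.of X).mulVec β + z) i - (Matrix.of X).mulVec b i) =
        (Matrix.of X).transpose.mulVec z j - ∑ i, X i j * (Matrix.of X).mulVec (b - β) i := by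
      rw [transpose_mulVec_eq_sum, ← Finset.sum_sub_distrib]
      refine Finset.sum_congr rfl fun i _ => ?_
      rw [Matrix.mulVec_sub]
      simp only [Pi.add_apply, Pi.sub_apply, Matrix.of_apply]
      ring
    rw [e]
    refine (abs_sub _ _).trans_lt ?_
    linarith
  refine (measure_mono hsub).trans ((measure_union_le _ _).trans (add_le_add
    ((measure_union_le _ _).trans (add_le_add le_rfl hF))
    ((measure_biUnion_finset_le _ _).trans ?_)))
  refine (Finset.sum_le_card_nsmul _ _ _ fun j _ =>
    gaussMat_leakEvent_le hn hr0 hu1 hzu hβ ha.le hlam hρ hc j).trans ?_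
  rw [Finset.card_univ, Fintype.card_fin, nsmul_eq_mul]

end Screening

/-! ### Assembling the finite-sample bound -/

section FiniteSample

variable {n p : ℕ}

/-- The noise is `σ` times a standard Gaussian vector. Since `t < 1`, the lower chi-square tail also
excludes `z = 0`, as the normalization of `z` requires. -/
theorem noise_norm_le (hn : 0 < n) {σ : ℝ} (hσ : 0 < σ) {t R : ℝ} (ht0 : 0 ≤ t) (ht1 : t < 1)
    (hR0 : 0 ≤ R) (hR : σ ^ 2 * (n * (1 + t)) ≤ R ^ 2) :
    (Measure.pi fun _ : Fin n => gaussianReal 0 (Real.toNNReal (σ ^ 2)))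
      {z | ¬ (0 < ∑ i, z i ^ 2 ∧ √(∑ i, z i ^ 2) ≤ R)} ≤
      ENNReal.ofReal (2 * Real.exp (-(n * t ^ 2 / 8))) := by
  have hn' : (0 : ℝ) < n := by exact_mod_cast hn
  have hmap : (gaussVec (Fin n)).map (fun g i => σ * g i) =
      Measure.pi fun _ : Fin n => gaussianReal 0 (Real.toNNReal (σ ^ 2)) := by
    refine (measurePreserving_pi (fun _ : Fin n => gaussianReal 0 1)
      (fun _ : Fin n => gaussianReal 0 (Real.toNNReal (σ ^ 2))) (f := fun _ x => σ * x)
      fun i => ⟨by fun_prop, ?_⟩).map_eq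
    rw [gaussianReal_map_const_mul]
    congr 1
    · simp
    · ext
      simp [Real.coe_toNNReal _ (sq_nonneg σ)]
  have hmeas : MeasurableSet {z : Fin n → ℝ | ¬ (0 < ∑ i, z i ^ 2 ∧ √(∑ i, z i ^ 2) ≤ R)} := by
    have h1 : MeasurableSet {z : Fin n → ℝ | 0 < ∑ i, z i ^ 2} := by
      refine measurableSet_lt ?_ ?_ <;> fun_prop
    have h2 : MeasurableSet {z : Fin n → ℝ | √(∑ i, z i ^ 2) ≤ R} := by
      refine measurableSet_le ?_ ?_ <;> fun_prop
    exact (h1.inter h2).compl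
  rw [← hmap, Measure.map_apply (by fun_prop) hmeas]
  have htail := gaussVec_abs_sum_sq_sub_gt_le (ι := Fin n) ht0 ht1.le
  rw [Fintype.card_fin] at htail
  refine (measure_mono fun g hg => ?_).trans htail
  by_contra hgood
  refine hg ?_
  have h0 : |∑ i, g i ^ 2 - n| ≤ t * n := not_lt.1 fun h => hgood h
  have h1 := abs_le.1 h0
  have e : ∑ i, (σ * g i) ^ 2 = σ ^ 2 * ∑ i, g i ^ 2 := by
    simp_rw [mul_pow]
    rw [Finset.mul_sum]
  have h2 : 0 < ∑ i, g i ^ 2 := by nlinarith [h1.1]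
  refine ⟨by rw [e]; positivity, ?_⟩
  rw [e, Real.sqrt_le_left hR0]
  refine le_trans (mul_le_mul_of_nonneg_left ?_ (sq_nonneg σ)) hR
  linarith [h1.2]

/-- Off the screened set `β` vanishes and `|X_jᵀz|/n ≤ aR/n ≤ λ`, so the threshold returns zero. -/
theorem supp_oracle_subset_screenedSet (hn : 0 < n) {X : Matrix (Fin n) (Fin p) ℝ}
    {β : Fin p → ℝ} {z : Fin n → ℝ} {a lam R : ℝ} (ha : 0 ≤ a) (hzR : √(∑ i, z i ^ 2) ≤ R)
    (hlam : a * R ≤ n * lam) : supp (oracle X β z lam) ⊆ screenedSet X z (supp β) a := by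
  have hn' : (0 : ℝ) < n := by exact_mod_cast hn
  intro j hj
  by_contra hjT
  have h1 : ¬ (j ∈ supp β ∨ _) := fun h => hjT (mem_screenedSet.2 h)
  have h2 := not_lt.1 fun h => h1 (Or.inr h)
  have hβ : β j = 0 := by
    by_contra h
    exact h1 (Or.inl (Finset.mem_filter.2 ⟨Finset.mem_univ j, h⟩))
  refine (Finset.mem_filter.1 hj).2 ?_
  have h3 : |(β + (n : ℝ)⁻¹ • X.transpose.mulVec z) j| ≤ lam := by
    simp only [Pi.add_apply, hβ, zero_add, Pi.smul_apply, smul_eq_mul]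
    rw [abs_mul, abs_of_pos (inv_pos.2 hn'), inv_mul_le_iff₀ hn']
    exact (h2.trans (mul_le_mul_of_nonneg_left hzR ha)).trans hlam
  simp only [oracle, softThreshold]
  rw [max_eq_right (sub_nonpos.2 h3), mul_zero]

/-- A screened index missing from `Sstar` would force all of `T` to be screened too, giving `m - k +
1 > k` screened indices outside `S`. -/
theorem IsResolventSet.screenedSet_subset {X : Matrix (Fin n) (Fin p) ℝ} {z : Fin n → ℝ}
    {S Sstar : Finset (Fin p)} {k m : ℕ} {a : ℝ} (hkm : 2 * k ≤ m)
    (hcard : (screenedSet X z S a \ S).card ≤ k) (h : IsResolventSet X z S k m Sstar) :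
    screenedSet X z S a ⊆ Sstar := by
  obtain ⟨T, hST, hT, hmax, rfl⟩ := h
  intro l hl
  by_contra hlS
  rw [Finset.mem_union, not_or] at hlS
  have h1 := (mem_screenedSet.1 hl).resolve_left hlS.1
  have hsub : insert l T ⊆ screenedSet X z S a \ S := by
    intro i hi
    rcases Finset.mem_insert.1 hi with rfl | hi
    · exact Finset.mem_sdiff.2 ⟨hl, hlS.1⟩
    · exact Finset.mem_sdiff.2 ⟨mem_screenedSet.2 (Or.inr (h1.trans_le (hmax i hi l hlS.1 hlS.2))),
        fun hiS => Finset.disjoint_left.1 hST hiS hi⟩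
  have h2 := Finset.card_le_card hsub
  rw [Finset.card_insert_of_notMem hlS.2] at h2
  omega

/-- Outside the screening failure, under restricted isometry and if the noise is not too large,
every resolvent set is good. -/
theorem mem_resolventEvent (hn : 0 < n) {X : Fin n → Fin p → ℝ} {z : Fin n → ℝ} {β : Fin p → ℝ}
    {k m : ℕ} {σ ε a R : ℝ} (hβ : β ∈ sparseVectors p k) (hkm : 2 * k ≤ m)
    (hmp : m ≤ p) (ha : 0 ≤ a) (hzR : √(∑ i, z i ^ 2) ≤ R)
    (hlam : a * R ≤ n * tuning n p k σ ε)
    (hRIP : ∀ A : Finset (Fin p), A.card = m → RestrictedIsometry X A (gap n p m))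
    (hscr : (X, z) ∉ screeningFailure n p k β (supp β) a (tuning n p k σ ε)) :
    (X, z) ∈ resolventEvent n p k m σ ε β := by
  have hS : (supp β).card ≤ k := hβ
  have h1 : ∀ b, IsLasso (Matrix.of X) (response (Matrix.of X) β z) (tuning n p k σ ε) b →
      supp b ⊆ screenedSet (Matrix.of X) z (supp β) a := by
    intro b hb
    by_contra h
    exact hscr (Or.inl ⟨b, hb, h⟩)
  have h2 : (screenedSet (Matrix.of X) z (supp β) a \ supp β).card ≤ k := by
    by_contra! h
    exact hscr (Or.inr h)
  refine ⟨exists_isResolventSet _ _ _ _ _ (by omega), fun Sstar hres => ?_⟩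
  have hsub := hres.screenedSet_subset hkm h2
  refine ⟨fun b hb => (h1 b hb).trans hsub,
    (supp_oracle_subset_screenedSet hn ha hzR hlam).trans hsub,
    Finset.subset_union_left.trans hsub, fun t ht => ?_⟩
  have hcard : Sstar.card ≤ m := by
    obtain ⟨T, -, hT, -, rfl⟩ := hres
    have := Finset.card_union_le (supp β) T
    omega
  obtain ⟨A, hA, -, hAm⟩ := Finset.exists_subsuperset_card_eq (Finset.subset_univ Sstar) hcard
    (by rwa [Finset.card_univ, Fintype.card_fin])
  exact ((hRIP A hAm).mono hA).hasEigenvalue_gram hn ht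

theorem RestrictedIsometry.mono_right {X : Fin n → Fin p → ℝ} {A : Finset (Fin p)} {Δ Δ' : ℝ}
    (h : RestrictedIsometry X A Δ) (hΔ : Δ ≤ Δ') : RestrictedIsometry X A Δ' :=
  fun v hv => (h v hv).trans (mul_le_mul_of_nonneg_right
    (mul_le_mul_of_nonneg_right hΔ (Nat.cast_nonneg n)) (Finset.sum_nonneg fun _ _ => sq_nonneg _))

/-- Finite sample bound for the probability that the resolvent sets are not good. -/
theorem modelLaw_resolventEvent_compl_le (hn : 0 < n) {σ ε : ℝ} (hσ : 0 < σ) {β : Fin p → ℝ}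
    {k m : ℕ} (hβ : β ∈ sparseVectors p k) (hk : 0 < k) (hkm : 2 * k ≤ m) (hmp : m ≤ p)
    (hgap : gap n p m ≤ 1 / 2) {t R : ℝ} (ht0 : 0 ≤ t) (ht1 : t < 1) (hR0 : 0 ≤ R)
    (hR : σ ^ 2 * (n * (1 + t)) ≤ R ^ 2) {a s s' M ρ c : ℝ} (hs : 0 ≤ s) (hss' : s < s')
    (hs' : s' < 1 / 2) (ha : 0 < a) (hM : 0 < M) (hMa : M ≤ a ^ 2)
    (hpk : p * Real.exp (-(s * a ^ 2)) ≤ k) (hlam : 0 < tuning n p k σ ε) (hρ : 0 < ρ)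
    (hfit : 2 / n * (R * √(k * M) + n * tuning n p k σ ε * √m) ^ 2 ≤ ρ ^ 2)
    (hc : a * ρ ≤ c) (hdual : a * R + c ≤ n * tuning n p k σ ε) :
    modelLaw n p σ (resolventEvent n p k m σ ε β)ᶜ ≤
      2 * ((p.choose m * 9 ^ m : ℕ) *
        ENNReal.ofReal (2 * Real.exp (-(n * (gap n p m / 2) ^ 2 / 8)))) +
      ENNReal.ofReal (2 * ((s' - s)⁻¹ * (√(1 - 2 * s'))⁻¹) / M) +
      p * ENNReal.ofReal (2 * Real.exp (-((c - a * ρ) ^ 2 / (2 * ρ ^ 2)))) +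
      ENNReal.ofReal (2 * Real.exp (-(n * t ^ 2 / 8))) := by
  set lam := tuning n p k σ ε with hlamdef
  set E1 : ENNReal := (p.choose m * 9 ^ m : ℕ) *
    ENNReal.ofReal (2 * Real.exp (-(n * (gap n p m / 2) ^ 2 / 8))) with hE1
  set E2 := ENNReal.ofReal (2 * ((s' - s)⁻¹ * (√(1 - 2 * s'))⁻¹) / M) with hE2
  set E3 : ENNReal :=
    p * ENNReal.ofReal (2 * Real.exp (-((c - a * ρ) ^ 2 / (2 * ρ ^ 2)))) with hE3
  set E4 := ENNReal.ofReal (2 * Real.exp (-(n * t ^ 2 / 8))) with hE4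
  have hgap0 : 0 ≤ gap n p m := by
    unfold gap
    positivity
  have hc0 : 0 ≤ c := le_trans (by positivity) hc
  have hβ0 : ∀ l ∉ supp β, β l = 0 := by
    intro l hl
    by_contra h
    exact hl (Finset.mem_filter.2 ⟨Finset.mem_univ l, h⟩)
  let U : Set (Fin n → Fin p → ℝ) :=
    {X | ¬ ∀ A : Finset (Fin p), A.card = m → RestrictedIsometry X A (gap n p m)}
  let V : Set (Fin n → ℝ) := {z | ¬ (0 < ∑ i, z i ^ 2 ∧ √(∑ i, z i ^ 2) ≤ R)}
  let G : Set ((Fin n → Fin p → ℝ) × (Fin n → ℝ)) :=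
    screeningFailure n p k β (supp β) a lam ∩ {ω | 0 < ∑ i, ω.2 i ^ 2 ∧ √(∑ i, ω.2 i ^ 2) ≤ R}
  have hU : gaussMat (Fin n) (Fin p) U ≤ E1 := by
    have := gaussMat_not_restrictedIsometry_le n p m (t := gap n p m / 2) (by positivity)
      (by linarith)
    rwa [mul_div_cancel₀ _ (two_ne_zero' ℝ)] at this
  have hUhalf : gaussMat (Fin n) (Fin p)
      {X | ¬ ∀ A : Finset (Fin p), A.card = m → RestrictedIsometry X A (1 / 2)} ≤ E1 := by
    refine (measure_mono fun X hX => ?_).trans hU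
    exact fun h => hX fun A hA => (h A hA).mono_right hgap
  have hV := noise_norm_le hn hσ ht0 ht1 hR0 hR
  -- Fubini in `z`: for each admissible noise vector the fixed-noise bound applies, and for the
  -- others the section of `G` is empty.
  have hG : modelLaw n p σ G ≤ E1 + E2 + E3 := by
    have hGm : MeasurableSet G := by
      refine (measurableSet_screeningFailure n p k β (supp β) a lam).inter ?_
      have h1 : MeasurableSet {ω : (Fin n → Fin p → ℝ) × (Fin n → ℝ) | 0 < ∑ i, ω.2 i ^ 2} := by
        refine measurableSet_lt ?_ ?_ <;> fun_prop
      have h2 : MeasurableSet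
          {ω : (Fin n → Fin p → ℝ) × (Fin n → ℝ) | √(∑ i, ω.2 i ^ 2) ≤ R} := by
        refine measurableSet_le ?_ ?_ <;> fun_prop
      exact h1.inter h2
    unfold modelLaw
    rw [Measure.prod_apply_symm hGm]
    refine (lintegral_mono (g := fun _ => E1 + E2 + E3) fun z => ?_).trans ?_
    · by_cases hz : 0 < ∑ i, z i ^ 2 ∧ √(∑ i, z i ^ 2) ≤ R
      · refine (measure_mono (t := {X | (X, z) ∈ screeningFailure n p k β (supp β) a lam})
          fun X hX => hX.1).trans ?_
        refine (gaussMat_screeningFailure_le hn hz.1 hz.2 hβ0 hβ hk hkm hmp hs hss' hs' ha hM hMa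
          hpk hlam hρ hfit hc hdual).trans ?_
        exact add_le_add (add_le_add hUhalf le_rfl) le_rfl
      · have : (fun X : Fin n → Fin p → ℝ => (X, z)) ⁻¹' G = ∅ := by
          ext X
          exact ⟨fun h => hz h.2, fun h => h.elim⟩
        rw [this, measure_empty]
        exact zero_le
    · rw [lintegral_const, measure_univ, mul_one]
  have hsub : (resolventEvent n p k m σ ε β)ᶜ ⊆ (U ×ˢ Set.univ ∪ Set.univ ×ˢ V) ∪ G := by
    rintro ⟨X, z⟩ hω
    by_contra hgood
    simp only [Set.mem_union, not_or, Set.mem_prod, Set.mem_univ, and_true, true_and] at hgood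
    obtain ⟨⟨hXU, hzV⟩, hXz⟩ := hgood
    have hz := not_not.1 fun h => hzV h
    have hX := not_not.1 fun h => hXU h
    exact hω (mem_resolventEvent hn hβ hkm hmp ha.le hz.2 (by linarith) hX
      fun h => hXz ⟨h, hz⟩)
  calc modelLaw n p σ (resolventEvent n p k m σ ε β)ᶜ
      ≤ modelLaw n p σ (U ×ˢ Set.univ) + modelLaw n p σ (Set.univ ×ˢ V) + modelLaw n p σ G :=
        (measure_mono hsub).trans ((measure_union_le _ _).trans
          (add_le_add (measure_union_le _ _) le_rfl))
    -- `E1` is paid twice: for the isometry at level `gap`, and for the one at level `1/2` inside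
    -- the screening bound.
    _ ≤ E1 + E4 + (E1 + E2 + E3) := by
        refine add_le_add (add_le_add ?_ ?_) hG
        · unfold modelLaw
          rw [Measure.prod_prod, measure_univ, mul_one]
          exact hU
        · unfold modelLaw
          rw [Measure.prod_prod, measure_univ, one_mul]
          exact hV
    _ = 2 * E1 + E2 + E3 + E4 := by ring

end FiniteSample

/-! ### Choice of the constants and passage to the limit -/

section Asymptotics

/-- With `L = log(p/m)`, the number of sets is at most `exp(mL + m)` and each net has at most
`exp(3m)` points. The factor `10` in `gap` makes the tail exponent `25mL/8`, which for `L ≥ 4` beats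
`mL + 4m ≤ 2mL` by at least `L`. -/
theorem choose_mul_pow_mul_exp_le {n p m : ℕ} (hn : 0 < n) (hm : 0 < m) (hmp : m ≤ p)
    (hL : 4 ≤ Real.log ((p : ℝ) / m)) :
    ((p.choose m * 9 ^ m : ℕ) : ENNReal) *
        ENNReal.ofReal (2 * Real.exp (-(n * (gap n p m / 2) ^ 2 / 8))) ≤
      ENNReal.ofReal (2 * Real.exp (-Real.log ((p : ℝ) / m))) := by
  set L := Real.log ((p : ℝ) / m) with hLdef
  have hn' : (0 : ℝ) < n := by exact_mod_cast hn
  have hm' : (0 : ℝ) < m := by exact_mod_cast hm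
  have hm1 : (1 : ℝ) ≤ m := by exact_mod_cast hm
  have hp' : (0 : ℝ) < p := by exact_mod_cast hm.trans_le hmp
  have hgap : n * (gap n p m / 2) ^ 2 / 8 = 25 / 8 * (m * L) := by
    unfold gap
    rw [← hLdef, div_pow, mul_pow, Real.sq_sqrt (by positivity)]
    field_simp
    norm_num
  have h1 : (p.choose m : ℝ) ≤ Real.exp (m * L) * Real.exp m := by
    have h2 := Nat.choose_le_pow_div (α := ℝ) m p
    have h3 := Real.pow_div_factorial_le_exp (m : ℝ) hm'.le m
    have h4 : Real.exp (m * L) = ((p : ℝ) / m) ^ m := by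
      rw [Real.exp_nat_mul, hLdef, Real.exp_log (by positivity)]
    rw [h4]
    refine h2.trans (le_trans (le_of_eq ?_) (mul_le_mul_of_nonneg_left h3 (by positivity)))
    rw [div_pow]
    field_simp
  have h9 : (9 : ℝ) ^ m ≤ Real.exp (3 * m) := by
    rw [mul_comm, Real.exp_nat_mul]
    refine pow_le_pow_left₀ (by norm_num) ?_ m
    have h3 : Real.exp 3 = Real.exp 1 ^ 3 := by
      rw [← Real.exp_nat_mul]
      norm_num
    have h4 := Real.exp_one_gt_d9
    rw [h3]
    nlinarith [pow_le_pow_left₀ (by norm_num) h4.le 3]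
  rw [← ENNReal.ofReal_natCast, ← ENNReal.ofReal_mul (Nat.cast_nonneg _), hgap]
  refine ENNReal.ofReal_le_ofReal ?_
  push_cast
  calc (p.choose m : ℝ) * 9 ^ m * (2 * Real.exp (-(25 / 8 * (m * L))))
      ≤ (Real.exp (m * L) * Real.exp m) * Real.exp (3 * m) *
          (2 * Real.exp (-(25 / 8 * (m * L)))) := by gcongr
    _ = 2 * Real.exp (m * L + m + 3 * m + -(25 / 8 * (m * L))) := by
        rw [Real.exp_add, Real.exp_add, Real.exp_add]
        ring
    _ ≤ 2 * Real.exp (-L) := by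
        refine mul_le_mul_of_nonneg_left (Real.exp_le_exp.2 ?_) two_pos.le
        nlinarith [mul_le_mul_of_nonneg_left hL hm'.le,
          mul_le_mul_of_nonneg_right hm1 (by linarith : (0 : ℝ) ≤ L)]

set_option maxHeartbeats 1000000 in
/-- The probability that the resolvent sets are not good is bounded in terms of `log (p / k*)`
once `k* log p / n` is small. -/
theorem exists_modelLaw_resolventEvent_compl_le {σ ε : ℝ} (hσ : 0 < σ) (hε : 0 < ε) :
    ∃ η D τ : ℝ, 0 < η ∧ 0 < τ ∧ ∀ n p k m : ℕ, 0 < n → 0 < k → 2 * k ≤ m → m ≤ p →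
      4 ≤ Real.log ((p : ℝ) / m) → (m : ℝ) * Real.log p / n ≤ η →
      ∀ β ∈ sparseVectors p k, modelLaw n p σ (resolventEvent n p k m σ ε β)ᶜ ≤
        2 * ENNReal.ofReal (2 * Real.exp (-Real.log ((p : ℝ) / m))) +
        ENNReal.ofReal (D / Real.log ((p : ℝ) / m)) +
        ENNReal.ofReal (2 * Real.exp (-Real.log ((p : ℝ) / m))) +
        ENNReal.ofReal (2 * Real.exp (-(τ * Real.log ((p : ℝ) / m)))) := by
  -- The slack `ε` in `λ` is shared out: `ε/4` goes to the screening level `a`, the factor `q`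
  -- allows for fluctuation of `‖z‖` so that `aR = (1 + ε/2)σ√(2n log(p/k))`, and the remaining
  -- `ε/2` is left for the leakage `c`.
  set q : ℝ := (1 + ε / 2) / (1 + ε / 4) with hq
  have hq1 : 1 < q := by
    rw [hq, one_lt_div (by positivity)]
    linarith
  have hq2 : q ≤ 2 := by
    rw [hq, div_le_iff₀ (by positivity)]
    linarith
  set t : ℝ := min (q ^ 2 - 1) (1 / 2) with ht
  have ht0 : 0 < t := lt_min (by nlinarith) (by norm_num)
  have ht1 : t < 1 := (min_le_right _ _).trans_lt (by norm_num)
  have htq : 1 + t ≤ q ^ 2 := by linarith [min_le_left (q ^ 2 - 1) (1 / 2 : ℝ)]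
  -- This `s` gives `s a² = log(p/k)`, hence `p exp(-sa²) = k`. It is below `1/2` because `a`
  -- exceeds `√(2 log(p/k))`, which leaves room for `s'`.
  set s : ℝ := 1 / (2 * (1 + ε / 4) ^ 2) with hs
  have hs0 : 0 < s := by positivity
  have hs1 : s < 1 / 2 := by
    rw [hs]
    refine one_div_lt_one_div_of_lt two_pos ?_
    nlinarith
  set s' : ℝ := (s + 1 / 2) / 2 with hs'
  have hss' : s < s' := by linarith
  have hs'1 : s' < 1 / 2 := by linarith
  set D : ℝ := 2 * ((s' - s)⁻¹ * (√(1 - 2 * s'))⁻¹) with hD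
  have hD0 : 0 ≤ D := by
    have : 0 < s' - s := sub_pos.2 hss'
    positivity
  set C : ℝ := 2 * (3 + ε) with hC
  have hC0 : 0 < C := by positivity
  set e0 : ℝ := ε / 4 / ((1 + ε / 4) * C) with he0
  have he00 : 0 < e0 := by positivity
  set C2 : ℝ := (ε / 4) ^ 2 / (2 * C ^ 2) with hC2
  have hC20 : 0 < C2 := by positivity
  -- The four thresholds yield in turn `gap ≤ 1/2`, `L ≤ n`, the bound `aρ ≤ c/2` (through
  -- `hsmall`), and a leakage exponent of at least `2 log p`, which absorbs the union over `p`
  -- columns.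
  refine ⟨min (min (1 / 400) 1) (min (e0 ^ 2 / 2) (C2 / 2)), D, t ^ 2 / 8, by positivity,
    by positivity, ?_⟩
  intro n p k m hn hk hkm hmp hL hη β hβ
  set L := Real.log ((p : ℝ) / m) with hLdef
  have hη1 := hη.trans ((min_le_left _ _).trans (min_le_left _ _))
  have hη2 := hη.trans ((min_le_left _ _).trans (min_le_right _ _))
  have hη3 := hη.trans ((min_le_right _ _).trans (min_le_left _ _))
  have hη4 := hη.trans ((min_le_right _ _).trans (min_le_right _ _))
  have hm : 0 < m := by omega
  have hn' : (0 : ℝ) < n := by exact_mod_cast hn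
  have hk' : (0 : ℝ) < k := by exact_mod_cast hk
  have hk1 : (1 : ℝ) ≤ k := by exact_mod_cast hk
  have hm' : (0 : ℝ) < m := by exact_mod_cast hm
  have hm1 : (1 : ℝ) ≤ m := by exact_mod_cast hm
  have hp' : (0 : ℝ) < p := by exact_mod_cast hm.trans_le hmp
  have hkm' : (k : ℝ) ≤ m := by exact_mod_cast (by omega : k ≤ m)
  set L' := Real.log ((p : ℝ) / k) with hL'def
  have hLL' : L ≤ L' := Real.log_le_log (by positivity) (by gcongr)
  have hL'p : L' ≤ Real.log p := Real.log_le_log (by positivity) (div_le_self hp'.le hk1)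
  have hL'0 : 0 < L' := by linarith
  have hLp : L ≤ Real.log p := hLL'.trans hL'p
  rw [div_le_iff₀ hn'] at hη1 hη2 hη3 hη4
  set N := √(n : ℝ) with hN
  set Y := √(2 * L') with hY
  set κ := √(m : ℝ) with hκ
  have hN0 : 0 < N := Real.sqrt_pos.2 hn'
  have hY0 : 0 < Y := Real.sqrt_pos.2 (by positivity)
  have hκ0 : 0 < κ := Real.sqrt_pos.2 hm'
  have hN2 : N ^ 2 = n := Real.sq_sqrt hn'.le
  have hY2 : Y ^ 2 = 2 * L' := Real.sq_sqrt (by positivity)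
  have hκ2 : κ ^ 2 = m := Real.sq_sqrt hm'.le
  have hlam : tuning n p k σ ε = (1 + ε) * σ * (Y / N) := by
    unfold tuning
    rw [Real.sqrt_div (by positivity)]
  have hnlam : n * tuning n p k σ ε = (1 + ε) * σ * (Y * N) := by
    rw [hlam, ← hN2]
    field_simp
  have hgap : gap n p m ≤ 1 / 2 := by
    unfold gap
    rw [← hLdef]
    have h1 : √((m : ℝ) * L / n) ≤ 1 / 20 := by
      rw [Real.sqrt_le_left (by norm_num), div_le_iff₀ hn']
      have := mul_le_mul_of_nonneg_left hLp hm'.le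
      linarith
    linarith
  have hsmall : κ * Y ≤ e0 * N := by
    refine abs_le_of_sq_le_sq' ?_ (by positivity) |>.2
    rw [mul_pow, mul_pow, hκ2, hY2, hN2]
    have := mul_le_mul_of_nonneg_left hL'p hm'.le
    linarith
  have hCe : (1 + ε / 4) * C * e0 = ε / 4 := by
    rw [he0]
    field_simp
  have haρ : (1 + ε / 4) * Y * (C * σ * κ * Y) ≤ ε / 4 * σ * (Y * N) := by
    calc (1 + ε / 4) * Y * (C * σ * κ * Y) = (1 + ε / 4) * C * σ * Y * (κ * Y) := by ring
      _ ≤ (1 + ε / 4) * C * σ * Y * (e0 * N) := mul_le_mul_of_nonneg_left hsmall (by positivity)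
      _ = (1 + ε / 4) * C * e0 * σ * (Y * N) := by ring
      _ = _ := by rw [hCe]
  have haR : (1 + ε / 4) * Y * (σ * N * q) = (1 + ε / 2) * σ * (Y * N) := by
    rw [hq]
    field_simp
  have hc0 : 0 < ε / 4 * σ * (Y * N) := by positivity
  have hfit : 2 / (n : ℝ) * (σ * N * q * √(k * L') + n * tuning n p k σ ε * √m) ^ 2 ≤
      (C * σ * κ * Y) ^ 2 := by
    have h1 : √(k * L') ≤ κ * Y := by
      rw [Real.sqrt_le_left (by positivity), mul_pow, hκ2, hY2]
      linarith [mul_le_mul_of_nonneg_right hkm' hL'0.le, mul_pos hm' hL'0]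
    have h2 : σ * N * q * √(k * L') + n * tuning n p k σ ε * √m ≤ (3 + ε) * σ * N * (κ * Y) := by
      rw [hnlam]
      have h3 : σ * N * q * √(k * L') ≤ σ * N * 2 * (κ * Y) := by gcongr
      have h4 : (1 + ε) * σ * (Y * N) * √m = (1 + ε) * σ * N * (κ * Y) := by
        rw [← hκ]
        ring
      rw [h4]
      linarith
    have h5 : 0 ≤ σ * N * q * √(k * L') + n * tuning n p k σ ε * √m := by
      rw [hnlam]
      positivity
    have h6 := pow_le_pow_left₀ h5 h2 2
    calc 2 / (n : ℝ) * (σ * N * q * √(k * L') + n * tuning n p k σ ε * √m) ^ 2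
        ≤ 2 / (n : ℝ) * ((3 + ε) * σ * N * (κ * Y)) ^ 2 :=
          mul_le_mul_of_nonneg_left h6 (by positivity)
      _ = 2 * ((3 + ε) * σ * (κ * Y)) ^ 2 := by
          rw [← hN2]
          field_simp
      _ ≤ _ := by
          have h7 : (C * σ * κ * Y) ^ 2 = 4 * ((3 + ε) * σ * (κ * Y)) ^ 2 := by
            rw [hC]
            ring
          linarith [sq_nonneg ((3 + ε) * σ * (κ * Y))]
  have hexp : s * ((1 + ε / 4) * Y) ^ 2 = L' := by
    rw [hs, mul_pow, hY2]
    field_simp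
  have hpk : p * Real.exp (-(s * ((1 + ε / 4) * Y) ^ 2)) ≤ k := by
    rw [hexp, Real.exp_neg, hL'def, Real.exp_log (by positivity)]
    rw [inv_div]
    field_simp
    exact le_rfl
  have hMa : L' ≤ ((1 + ε / 4) * Y) ^ 2 := by
    rw [mul_pow, hY2]
    have h1 : 1 ≤ (1 + ε / 4) ^ 2 := one_le_pow₀ (by linarith)
    linarith [mul_le_mul_of_nonneg_right h1 (by positivity : 0 ≤ 2 * L')]
  -- With these choices `aR + c = nλ` exactly and `c - aρ ≥ (ε/4)σYN`. Taking `M = log(p/k)` is what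
  -- makes the energy error of order `1/log(p/k)`.
  have main := modelLaw_resolventEvent_compl_le hn hσ hβ hk hkm hmp hgap ht0.le ht1
    (R := σ * N * q) (by positivity) (by
      rw [mul_pow, mul_pow, hN2]
      have := mul_le_mul_of_nonneg_left htq (by positivity : 0 ≤ σ ^ 2 * n)
      linarith) (a := (1 + ε / 4) * Y) hs0.le hss' hs'1 (by positivity) hL'0 hMa hpk
    (by rw [hlam]; positivity) (ρ := C * σ * κ * Y) (by positivity) hfit
    (c := ε / 2 * σ * (Y * N)) (by linarith) (by rw [haR, hnlam]; linarith)
  refine main.trans (add_le_add (add_le_add (add_le_add ?_ ?_) ?_) ?_)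
  · exact mul_le_mul_right (choose_mul_pow_mul_exp_le hn hm hmp hL) 2
  · exact ENNReal.ofReal_le_ofReal (div_le_div_of_nonneg_left hD0 (by linarith) hLL')
  · rw [← ENNReal.ofReal_natCast, ← ENNReal.ofReal_mul (Nat.cast_nonneg _)]
    refine ENNReal.ofReal_le_ofReal ?_
    have h1 : 2 * Real.log p ≤ (ε / 2 * σ * (Y * N) - (1 + ε / 4) * Y * (C * σ * κ * Y)) ^ 2 /
        (2 * (C * σ * κ * Y) ^ 2) := by
      have h2 : (ε / 4 * σ * (Y * N)) ^ 2 ≤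
          (ε / 2 * σ * (Y * N) - (1 + ε / 4) * Y * (C * σ * κ * Y)) ^ 2 :=
        pow_le_pow_left₀ hc0.le (by linarith) 2
      refine le_trans ?_ (div_le_div_of_nonneg_right h2 (by positivity))
      have h3 : (ε / 4 * σ * (Y * N)) ^ 2 / (2 * (C * σ * κ * Y) ^ 2) = C2 * n / m := by
        rw [hC2, ← hN2, ← hκ2]
        field_simp
      rw [h3, le_div_iff₀ hm']
      linarith
    calc (p : ℝ) * (2 * Real.exp (-((ε / 2 * σ * (Y * N) - (1 + ε / 4) * Y * (C * σ * κ * Y)) ^ 2 /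
        (2 * (C * σ * κ * Y) ^ 2))))
        ≤ p * (2 * Real.exp (-(2 * Real.log p))) := by gcongr
      _ = 2 * Real.exp (-Real.log p) := by
        rw [show -(2 * Real.log p) = -Real.log p + -Real.log p by ring, Real.exp_add,
          Real.exp_neg, Real.exp_log hp']
        field_simp
      _ ≤ 2 * Real.exp (-L) := by gcongr
  · refine ENNReal.ofReal_le_ofReal (mul_le_mul_of_nonneg_left (Real.exp_le_exp.2 ?_) two_pos.le)
    have h1 : L ≤ n := by
      linarith [mul_le_mul_of_nonneg_right hm1 (by linarith : 0 ≤ Real.log p)]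
    linarith [mul_le_mul_of_nonneg_left h1 (sq_nonneg t)]

end Asymptotics

end SparseLasso

theorem proposition4p5 (σ ε : ℝ) (hσ : 0 < σ) (hε : 0 < ε)
    (n p k kstar : ℕ → ℕ)
    (hn : ∀ m, 1 ≤ n m) (hp : ∀ m, 1 ≤ p m) (hk : ∀ m, 1 ≤ k m)
    (hkstar : ∀ m, 2 * k m ≤ kstar m)
    (hlim_p : Tendsto (fun m => (kstar m : ℝ) / (p m : ℝ)) atTop (𝓝 0))
    (hlim_n : Tendsto (fun m => (kstar m : ℝ) * Real.log (p m : ℝ) / (n m : ℝ))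
      atTop (𝓝 0)) :
    Tendsto (fun m => ⨆ β ∈ SparseLasso.sparseVectors (p m) (k m),
        SparseLasso.modelLaw (n m) (p m) σ
          (SparseLasso.resolventEvent (n m) (p m) (k m) (kstar m) σ ε β)ᶜ)
      atTop (𝓝 0) ∧
    Tendsto (fun m => ⨆ β ∈ SparseLasso.sparseVectors (p m) (k m),
        SparseLasso.modelLaw (n m) (p m) σ
          (SparseLasso.eventB (n m) (p m) (k m) σ ε
            (SparseLasso.gap (n m) (p m) (kstar m)) β)ᶜ)
      atTop (𝓝 0) := by
  have h1 : Tendsto (fun m => ⨆ β ∈ SparseLasso.sparseVectors (p m) (k m),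
      SparseLasso.modelLaw (n m) (p m) σ
        (SparseLasso.resolventEvent (n m) (p m) (k m) (kstar m) σ ε β)ᶜ) atTop (𝓝 0) := by
    obtain ⟨η, D, τ, hη, hτ, hbound⟩ :=
      SparseLasso.exists_modelLaw_resolventEvent_compl_le hσ hε
    have hL : Tendsto (fun m => Real.log ((p m : ℝ) / kstar m)) atTop atTop := by
      refine Real.tendsto_log_atTop.comp ?_
      have hpos : ∀ m, (0 : ℝ) < (kstar m : ℝ) / p m := fun m => by
        have h1 : 0 < kstar m := by have := hk m; have := hkstar m; omega
        have h2 : 0 < p m := hp m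
        positivity
      have h2 := (tendsto_nhdsWithin_iff.2 ⟨hlim_p, .of_forall hpos⟩ :
        Tendsto _ atTop (𝓝[>] (0 : ℝ))).inv_tendsto_nhdsGT_zero
      refine h2.congr fun m => ?_
      rw [Pi.inv_apply, inv_div]
    have hexp : ∀ c : ℝ, 0 < c → Tendsto (fun m => ENNReal.ofReal
        (2 * Real.exp (-(c * Real.log ((p m : ℝ) / kstar m))))) atTop (𝓝 0) := by
      intro c hc
      have h2 := (Real.tendsto_exp_neg_atTop_nhds_zero.comp (hL.const_mul_atTop hc)).const_mul 2
      rw [mul_zero] at h2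
      have h3 := ENNReal.tendsto_ofReal h2
      rw [ENNReal.ofReal_zero] at h3
      exact h3
    have hexp1 : Tendsto (fun m => ENNReal.ofReal
        (2 * Real.exp (-Real.log ((p m : ℝ) / kstar m)))) atTop (𝓝 0) := by
      simpa only [one_mul] using hexp 1 one_pos
    have hdiv : Tendsto (fun m => ENNReal.ofReal (D / Real.log ((p m : ℝ) / kstar m)))
        atTop (𝓝 0) := by
      have h3 := ENNReal.tendsto_ofReal (hL.const_div_atTop D)
      rwa [ENNReal.ofReal_zero] at h3
    have hlim := (((ENNReal.Tendsto.const_mul (a := 2) hexp1 (Or.inr (by simp))).add hdiv).add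
      hexp1).add (hexp τ hτ)
    simp only [mul_zero, add_zero] at hlim
    refine tendsto_of_tendsto_of_tendsto_of_le_of_le' tendsto_const_nhds hlim
      (.of_forall fun m => zero_le) ?_
    -- The condition `k*/p → 0` serves twice: it sends `log(p/k*)` to infinity and eventually gives
    -- `k* ≤ p`.
    filter_upwards [hL.eventually_ge_atTop 4, hlim_n.eventually_le_const hη,
      hlim_p.eventually_lt_const one_pos] with m hm1 hm2 hm3
    refine iSup₂_le fun β hβ => hbound (n m) (p m) (k m) (kstar m) (hn m) (hk m) (hkstar m) ?_
      hm1 hm2 β hβ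
    rw [div_lt_one (by exact_mod_cast hp m)] at hm3
    exact_mod_cast hm3.le
  refine ⟨h1, tendsto_of_tendsto_of_tendsto_of_le_of_le tendsto_const_nhds h1
    (fun m => zero_le) fun m => iSup₂_mono fun β _ => measure_mono ?_⟩
  -- The event includes existence of a resolvent set, which then witnesses the good set.
  refine Set.compl_subset_compl.2 fun ω hω => ?_
  obtain ⟨Sstar, hS⟩ := hω.1
  exact ⟨Sstar, hω.2 Sstar hS⟩
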